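/- Let $B_1=B_1(0)\subset\mathbb{R}^2$ be the open unit disc, let $\Omega'=\{x\in\mathbb{R}^2: x_1>0,\ x_2>0,\ x_1+x_2<\tfrac12\}$ be the open right isosceles triangle with vertices $(0,0)$, $(\tfrac12,0)$, $(0,\tfrac12)$, and let $\Gamma$ be the union of its three sides. Let $\mathcal H^1\llcorner\Gamma$ be the one-dimensional Hausdorff measure restricted to $\Gamma$. For a domain $D$ with $\overline{D}\subset B_1$, a very weak solution of $$-\Delta u=\mathcal H^1\llcorner\partial D\ \text{ in } B_1,\qquad u=0\ \text{ on }\partial B_1$$ is a function $u\in L^2(B_1)$ such that $-\int_{B_1}u\,\Delta\phi\,dx=\int_{\partial D}\phi\,d\mathcal H^1$ for all $\phi\in C^2(\overline{B_1})$ with $\phi=0$ on $\partial B_1$. A bounded domain has a Lipschitz boundary if, near each boundary point and after an orthogonal change of coordinates, its boundary is the graph of a Lipschitz function and the domain is the region below the graph. Then the following hold. 1. $\Omega'$ is a domain with $\overline{\Omega'}\subset B_1$, its boundary is $\partial\Omega'=\Gamma$, and $\Gamma$ is connected and Lipschitz. 2. The problem $-\Delta u=\mathcal H^1\llcorner\Gamma$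 in $B_1$, $u=0$ on $\partial B_1$, has a very weak solution, and this solution is unique up to equality almost everywhere. 3. This problem has no very weak solution in $W^{1,\infty}(B_1)$. 4. Near the corner $0$ the derivative $\partial_1u$ of the solution behaves like $-\frac1{2\pi}\log|x|$: there are $\varepsilon\in(0,1)$, $C\in\mathbb{R}$ and a representative of $u$ (again called $u$) that is $C^1$ on $B_\varepsilon(0)\setminus\Gamma$, whose pointwise derivative $\partial_1u$ there is the weak derivative $\partial_1u$ in $B_\varepsilon(0)$, and which satisfies $$\Bigl|\partial_1u(x)+\tfrac1{2\pi}\log|x|\Bigr|\le C\qquad\text{for all }x\in B_\varepsilon(0)\setminus\Gamma.$$ 5. Consequently, it is not true that for every domain $D$ with $\overline{D}\subset B_1$ and connected Lipschitz boundary, every very weak solution of $-\Delta u=\mathcal H^1\llcorner\partial D$ in $B_1$, $u=0$ on $\partial B_1$, lies in $W^{1,\infty}(B_1)$. Hence a $C^{1,\alpha}$ boundary cannot be weakened to a Lipschitz boundary in the $W^{1,\infty}$-regularity theorem for this problem. -/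

import Mathlib

open MeasureTheory Set Metric Filter Topology
open scoped ContDiff NNReal ENNReal

namespace SurfacePoisson

/-- The Euclidean plane. -/
abbrev Plane : Type := EuclideanSpace ℝ (Fin 2)

/-- The point with coordinates `a` and `b`. -/
noncomputable abbrev pt (a b : ℝ) : Plane := !₂[a, b]

/-- `i`-th standard basis vector. -/
noncomputable abbrev basisVec (i : Fin 2) : Plane := EuclideanSpace.single i 1

/-- The open unit disc. -/
abbrev unitDisc : Set Plane := ball (0 : Plane) 1

/-! ### Very weak solutions of the measure-valued Dirichlet problem -/

/-- `u` is a very weak solution of `-Δ u = μ` in `Ω`, `u = 0` on `∂Ω`: the function `u` is in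
`L²(Ω)`, and `-∫_Ω u Δφ = ∫ φ dμ` for all `φ ∈ C²(closure Ω)` that vanish on `∂Ω`. -/
structure IsVeryWeakSolution (Ω : Set Plane) (μ : Measure Plane) (u : Plane → ℝ) : Prop where
  memLp : MemLp u 2 (volume.restrict Ω)
  integral_eq : ∀ φ : Plane → ℝ, ContDiffOn ℝ 2 φ (closure Ω) → (∀ x ∈ frontier Ω, φ x = 0) →
    -∫ x in Ω, u x * Laplacian.laplacian φ x = ∫ y, φ y ∂μ

/-! ### Weak derivatives and `W^{1,∞}` -/

/-- `g` is the weak partial derivative `∂_i u` in the open set `Ω`. -/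
structure HasWeakPartialDeriv (Ω : Set Plane) (i : Fin 2) (u g : Plane → ℝ) : Prop where
  locallyIntegrableOn : LocallyIntegrableOn u Ω
  locallyIntegrableOn_deriv : LocallyIntegrableOn g Ω
  integral_eq : ∀ φ : Plane → ℝ, ContDiff ℝ ∞ φ → HasCompactSupport φ → tsupport φ ⊆ Ω →
    ∫ x in Ω, u x * fderiv ℝ φ x (basisVec i) = -∫ x in Ω, g x * φ x

/-- The Sobolev space `W^{1,∞}(Ω)`. -/
structure MemW1Infty (Ω : Set Plane) (u : Plane → ℝ) : Prop where
  memLp : MemLp u ∞ (volume.restrict Ω)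
  exists_deriv : ∀ i : Fin 2, ∃ g : Plane → ℝ,
    MemLp g ∞ (volume.restrict Ω) ∧ HasWeakPartialDeriv Ω i u g

/-! ### Lipschitz subdomains -/

/-- The open cylinder (rectangle) `U × V` with `U = (a - r, a + r)` and `V = (c, d)`. -/
def cylinder (a r c d : ℝ) : Set Plane := {z | z 0 ∈ ball a r ∧ z 1 ∈ Ioo c d}

/-- `∂D` is a `C^{0,1}`-boundary: near each of its points, after an orthogonal change of
coordinates, `∂D` is the graph of a Lipschitz function and `D` is its strict subgraph.  The function
is defined and Lipschitz on the closed interval with the same centre as `U` and four times its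
radius, with values in `V`.  For bounded `D`, compactness of `∂D` yields finitely many such
graphs that cover `∂D`. -/
def HasLipschitzBoundary (D : Set Plane) : Prop :=
  ∀ p ∈ frontier D, ∃ (O : Plane ≃ₗᵢ[ℝ] Plane) (a r c d : ℝ) (K : ℝ≥0) (f : ℝ → ℝ),
    LipschitzOnWith K f (closedBall a (4 * r)) ∧
    MapsTo f (closedBall a (4 * r)) (Ioo c d) ∧
    p ∈ O '' cylinder a r c d ∧
    frontier D ∩ O '' cylinder a r c d = O '' {z ∈ cylinder a r c d | z 1 = f (z 0)} ∧
    D ∩ O '' cylinder a r c d = O '' {z ∈ cylinder a r c d | z 1 < f (z 0)}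

/-- `D` is a domain that is compactly contained in `Ω` and has a connected Lipschitz boundary. -/
structure IsLipschitzSubdomain (Ω D : Set Plane) : Prop where
  isOpen : IsOpen D
  isConnected : IsConnected D
  isCompact_closure : IsCompact (closure D)
  closure_subset : closure D ⊆ Ω
  hasLipschitzBoundary : HasLipschitzBoundary D
  isConnected_frontier : IsConnected (frontier D)

/-! ### The triangle -/

/-- The open right isosceles triangle with vertices `(0, 0)`, `(1/2, 0)`, `(0, 1/2)`. -/
def triangle : Set Plane := {x | 0 < x 0 ∧ 0 < x 1 ∧ x 0 + x 1 < 1 / 2}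

/-- The union of the three sides of the triangle. -/
def triangleSides : Set Plane :=
  segment ℝ (pt 0 0) (pt (1 / 2) 0) ∪ segment ℝ (pt 0 0) (pt 0 (1 / 2)) ∪
    segment ℝ (pt (1 / 2) 0) (pt 0 (1 / 2))

/-- The measure `ℋ¹ ⌞ S`. -/
noncomputable abbrev lengthOn (S : Set Plane) : Measure Plane :=
  (Measure.hausdorffMeasure 1 : Measure Plane).restrict S

end SurfacePoisson

/-!
The solution is the Green potential `u(x) = ∫ G(x, y) dμ(y)` of the length measure `μ` on the
sides of the triangle, where `G` is the Green function of the unit disc.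

*Representation formula.*  Everything rests on `-∫ G(x, y) Δφ(x) dx = φ(y)` for `φ ∈ C²` on the
closed disc with zero boundary values (`integral_greenKernel_mul_laplacian`).  For `y = 0` it is
first verified when `Δφ` is a polynomial in `z` and its conjugate: there both the solution of the
Poisson problem and the integral against `log |z|` are explicit
(`exists_isPoissonSolution_monomial`).  These polynomials are uniformly dense by the
Stone–Weierstrass theorem (`exists_laplacian_approx`), and the maximum principle
(`abs_le_of_abs_laplacian_le`) controls the error in `φ(0)`.  A general `y` follows with the disc
automorphism that exchanges `0` and `y`, because the Laplacian is conformally covariant.  No Green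
identity, and hence no boundary integral over the circle, is needed.

*Existence and uniqueness.*  `G` is logarithmic, so it is square integrable against `dx ⊗ μ`; this
puts `u` in `L²`, and Fubini's theorem turns the representation formula into the very weak
formulation (`isVeryWeakSolution_greenPotential`).  Two solutions have a difference orthogonal to
all Laplacians of admissible test functions, and these are uniformly dense, so the difference is
zero (`ae_eq_zero_of_integral_mul_laplacian_eq_zero`).

*Singularity at the corner.*  Off the sides `u` may be differentiated under the integral sign.
The reflected part of `∂₁G` is bounded, and the remaining part is
`-(1 / 2π) (x₁ - y₁) / |x - y|²`.  Along the horizontal side this is, up to the factor, the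
derivative of `-log |x - y|` in the integration variable, so that this side contributes
`-(1 / 2π) log |x| + O(1)`.  Along the vertical side it is the derivative of an
arctangent, and the hypotenuse is away from the corner; both contributions are bounded
(`exists_abs_fderiv_trianglePotential_add_log_le`).  The pointwise
derivative is also the weak one, by Fubini's theorem and integration along those horizontal lines
that miss the pole (`hasWeakPartialDeriv_greenPotential`).  As weak derivatives are unique, `∂₁u`
is not essentially bounded near the corner, so `u` is not in `W^{1,∞}` (`not_memW1Infty`).

*The boundary is Lipschitz.*  Near each boundary point one of the three inequalities that define
the triangle is slack, and a rotation turns the other two into the strict subgraph of a minimum of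
two affine functions (`hasLipschitzBoundary_triangle`).
-/

namespace SurfacePoisson

open Laplacian InnerProductSpace ComplexConjugate

/-! ### The Laplacian in the plane -/

lemma laplacian_eq_fderiv_fderiv {F : Type*} [NormedAddCommGroup F] [NormedSpace ℝ F]
    (f : ℂ → F) (z : ℂ) :
    Δ f z = fderiv ℝ (fderiv ℝ f) z 1 1 + fderiv ℝ (fderiv ℝ f) z Complex.I Complex.I := by
  simp [laplacian_eq_iteratedFDeriv_complexPlane, iteratedFDeriv_two_apply]

lemma laplacian_comp_linearIsometryEquiv {E E' F : Type*} [NormedAddCommGroup E]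
    [InnerProductSpace ℝ E] [FiniteDimensional ℝ E] [NormedAddCommGroup E']
    [InnerProductSpace ℝ E'] [FiniteDimensional ℝ E'] [NormedAddCommGroup F] [NormedSpace ℝ F]
    (e : E ≃ₗᵢ[ℝ] E') (f : E' → F) (x : E) : Δ (f ∘ e) x = Δ f (e x) := by
  rw [laplacian_eq_iteratedFDeriv_orthonormalBasis (f ∘ e) (stdOrthonormalBasis ℝ E),
    laplacian_eq_iteratedFDeriv_orthonormalBasis f ((stdOrthonormalBasis ℝ E).map e)]
  refine Finset.sum_congr rfl fun i _ => ?_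
  have h := e.toContinuousLinearEquiv.iteratedFDerivWithin_comp_right f
    (s := univ) uniqueDiffOn_univ (x := x) (mem_univ _) 2
  simp only [preimage_univ, iteratedFDerivWithin_univ] at h
  have h2 : (f ∘ e) = f ∘ e.toContinuousLinearEquiv := rfl
  rw [h2, h]
  simp only [ContinuousMultilinearMap.compContinuousLinearMap_apply]
  congr 1
  ext j
  fin_cases j <;> rfl

/-- The Laplacian of a function whose first derivative is `v ↦ A v + B conj v`: with Wirtinger
derivatives `A = ∂f` and `B = ∂̄f`, it is `2 (∂̄A + ∂B)`. -/
lemma laplacian_of_wirtinger {f A B : ℂ → ℂ} {z A₁ A₂ B₁ B₂ : ℂ}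
    (hf : ∀ᶠ w in 𝓝 z, HasFDerivAt f (A w • ContinuousLinearMap.id ℝ ℂ +
      B w • (Complex.conjCLE : ℂ →L[ℝ] ℂ)) w)
    (hA : HasFDerivAt A (A₁ • ContinuousLinearMap.id ℝ ℂ +
      A₂ • (Complex.conjCLE : ℂ →L[ℝ] ℂ)) z)
    (hB : HasFDerivAt B (B₁ • ContinuousLinearMap.id ℝ ℂ +
      B₂ • (Complex.conjCLE : ℂ →L[ℝ] ℂ)) z) :
    Δ f z = 2 * (A₂ + B₁) := by
  have h1 : fderiv ℝ f =ᶠ[𝓝 z] fun w => A w • ContinuousLinearMap.id ℝ ℂ +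
      B w • (Complex.conjCLE : ℂ →L[ℝ] ℂ) := by
    filter_upwards [hf] with w hw using hw.fderiv
  have h2 := (hA.smul_const (ContinuousLinearMap.id ℝ ℂ)).add
    (hB.smul_const (Complex.conjCLE : ℂ →L[ℝ] ℂ))
  rw [laplacian_eq_fderiv_fderiv, h1.fderiv_eq]
  erw [h2.fderiv]
  simp
  ring_nf
  simp
  ring

/-- For `f = g · conj h` with `g` and `h` holomorphic, `Δ f = 4 g' conj h'`; here `g` and `h` are
powers. -/
lemma laplacian_monomial (a b : ℕ) (z : ℂ) :
    Δ (fun z : ℂ => z ^ (a + 1) * conj z ^ (b + 1)) z =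
      4 * ((a + 1) * (b + 1)) * (z ^ a * conj z ^ b) := by
  have hp : ∀ (n : ℕ) (w : ℂ), HasFDerivAt (fun z : ℂ => z ^ n)
      ((n * w ^ (n - 1)) • ContinuousLinearMap.id ℝ ℂ +
        (0 : ℂ) • (Complex.conjCLE : ℂ →L[ℝ] ℂ)) w := by
    intro n w
    refine ((hasDerivAt_pow n w).hasFDerivAt.restrictScalars ℝ).congr_fderiv ?_
    ext; simp [mul_comm]
  have hc : ∀ (n : ℕ) (w : ℂ), HasFDerivAt (fun z : ℂ => conj z ^ n)
      ((0 : ℂ) • ContinuousLinearMap.id ℝ ℂ +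
        (n * conj w ^ (n - 1)) • (Complex.conjCLE : ℂ →L[ℝ] ℂ)) w := by
    intro n w
    refine HasFDerivAt.congr_fderiv (HasFDerivAt.comp w
      ((hasDerivAt_pow n (conj w)).hasFDerivAt.restrictScalars ℝ)
      (Complex.conjCLE : ℂ →L[ℝ] ℂ).hasFDerivAt) ?_
    ext; simp [mul_comm]
  have hm : ∀ (m n : ℕ) (w : ℂ), HasFDerivAt (fun z : ℂ => z ^ m * conj z ^ n)
      ((m * w ^ (m - 1) * conj w ^ n) • ContinuousLinearMap.id ℝ ℂ +
        (n * (w ^ m * conj w ^ (n - 1))) • (Complex.conjCLE : ℂ →L[ℝ] ℂ)) w := by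
    intro m n w
    refine ((hp m w).mul (hc n w)).congr_fderiv ?_
    ext; simp; ring
  have hA := (hm a (b + 1) z).const_mul ((a : ℂ) + 1)
  have hB := (hm (a + 1) b z).const_mul ((b : ℂ) + 1)
  rw [laplacian_of_wirtinger (Eventually.of_forall (hm (a + 1) (b + 1)))
    (A₁ := (a + 1) * (a * z ^ (a - 1) * conj z ^ (b + 1)))
    (A₂ := (a + 1) * ((b + 1) * (z ^ a * conj z ^ b)))
    (B₁ := (b + 1) * ((a + 1) * (z ^ a * conj z ^ b)))
    (B₂ := (b + 1) * (b * (z ^ (a + 1) * conj z ^ (b - 1))))]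
  · ring
  · refine (hA.congr_fderiv ?_).congr_of_eventuallyEq (Eventually.of_forall fun w => ?_)
    · ext; simp; ring
    · simp; ring
  · refine (hB.congr_fderiv ?_).congr_of_eventuallyEq (Eventually.of_forall fun w => ?_)
    · ext; simp; ring
    · simp

/-- The Laplacian of `φ ∈ C²(closedBall 0 1)` extends continuously to the closed ball. -/
lemma exists_continuousOn_eq_laplacian {φ : ℂ → ℝ} (hφ : ContDiffOn ℝ 2 φ (closedBall 0 1)) :
    ∃ F : ℂ → ℝ, ContinuousOn F (closedBall 0 1) ∧ ∀ z ∈ ball (0 : ℂ) 1, F z = Δ φ z := by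
  have hs : UniqueDiffOn ℝ (closedBall (0 : ℂ) 1) :=
    uniqueDiffOn_convex (convex_closedBall _ _) (by rw [interior_closedBall _ one_ne_zero]; simp)
  refine ⟨laplacianWithin φ (closedBall 0 1), ?_, fun z hz => ?_⟩
  · have h := hφ.continuousOn_iteratedFDerivWithin (m := 2) le_rfl hs
    have : EqOn (laplacianWithin φ (closedBall 0 1)) (fun z =>
        iteratedFDerivWithin ℝ 2 φ (closedBall 0 1) z ![1, 1]
      + iteratedFDerivWithin ℝ 2 φ (closedBall 0 1) z ![Complex.I, Complex.I]) (closedBall 0 1) :=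
      fun z hz => laplacianWithin_eq_iteratedFDerivWithin_complexPlane φ hs hz
    refine ContinuousOn.congr ?_ this
    have hev : ∀ v : Fin 2 → ℂ, ContinuousOn (fun z =>
        iteratedFDerivWithin ℝ 2 φ (closedBall 0 1) z v) (closedBall 0 1) := fun v =>
      (ContinuousMultilinearMap.apply ℝ (fun _ : Fin 2 => ℂ) ℝ v).continuous.comp_continuousOn h
    exact (hev _).add (hev _)
  · have hz' := ball_subset_closedBall hz
    have hn : closedBall (0 : ℂ) 1 ∈ 𝓝 z :=
      mem_of_superset (isOpen_ball.mem_nhds hz) ball_subset_closedBall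
    rw [laplacianWithin_eq_iteratedFDerivWithin_complexPlane φ hs hz',
      laplacian_eq_iteratedFDeriv_complexPlane,
      iteratedFDerivWithin_eq_iteratedFDeriv hs (hφ.contDiffAt hn) hz']

/-! ### The maximum principle -/

/-- The second derivative test: the Laplacian is nonpositive at an interior maximum. -/
lemma laplacian_nonpos_of_isLocalMax {ψ : ℂ → ℝ} {z : ℂ} (hψ : ContDiffAt ℝ 2 ψ z)
    (hz : IsLocalMax ψ z) : Δ ψ z ≤ 0 := by
  have key : ∀ v : ℂ, fderiv ℝ (fderiv ℝ ψ) z v v ≤ 0 := by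
    intro v
    by_contra! hpos
    have hl : ∀ t : ℝ, HasDerivAt (fun t : ℝ => z + t • v) v t := fun t => by
      simpa using ((hasDerivAt_id t).smul_const v).const_add z
    have hl0 : Tendsto (fun t : ℝ => z + t • v) (𝓝 0) (𝓝 z) := by
      have := (hl 0).continuousAt
      simpa [ContinuousAt] using this
    have hev : ∀ᶠ w in 𝓝 z, DifferentiableAt ℝ ψ w := by
      filter_upwards [hψ.eventually (by simp)] with w hw
      exact hw.differentiableAt (by norm_num)
    set g : ℝ → ℝ := fun t => ψ (z + t • v)
    have hg1 : deriv g =ᶠ[𝓝 0] fun t => fderiv ℝ ψ (z + t • v) v := by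
      filter_upwards [hl0.eventually hev] with t ht
      exact (ht.hasFDerivAt.comp_hasDerivAt t (hl t)).deriv
    have hd : DifferentiableAt ℝ (fderiv ℝ ψ) z :=
      (hψ.fderiv_right (m := 1) (by norm_num)).differentiableAt (by norm_num)
    have hg2 : deriv (deriv g) 0 = fderiv ℝ (fderiv ℝ ψ) z v v := by
      rw [hg1.deriv_eq]
      have h0 : z + (0 : ℝ) • v = z := by simp
      have h1 : HasFDerivAt (fderiv ℝ ψ) (fderiv ℝ (fderiv ℝ ψ) z) (z + (0 : ℝ) • v) := by
        rw [h0]; exact hd.hasFDerivAt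
      have h2 : HasDerivAt (fun t : ℝ => fderiv ℝ ψ (z + t • v)) (fderiv ℝ (fderiv ℝ ψ) z v) 0 :=
        HasFDerivAt.comp_hasDerivAt (0 : ℝ) h1 (hl 0)
      have h3 := (h2.clm_apply (hasDerivAt_const (0 : ℝ) v)).deriv
      rw [h3, map_zero, add_zero]
    have hmax : IsLocalMax g 0 := by
      filter_upwards [hl0.eventually hz] with t ht
      simpa [g] using ht
    have hcont : ContinuousAt g 0 := by
      have h0 : g 0 = ψ z := by simp [g]
      rw [ContinuousAt, h0]
      exact hψ.continuousAt.tendsto.comp hl0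
    have hmin := isLocalMin_of_deriv_deriv_pos (hg2 ▸ hpos) hmax.deriv_eq_zero hcont
    have hc : g =ᶠ[𝓝 0] fun _ => g 0 := by
      filter_upwards [hmax, hmin] with t h1 h2 using le_antisymm h1 h2
    have h3 : deriv (deriv g) 0 = 0 := by
      rw [hc.deriv.deriv_eq]; simp
    rw [h3] at hg2
    exact hpos.ne hg2
  rw [laplacian_eq_fderiv_fderiv]
  exact add_nonpos (key _) (key _)

lemma laplacian_norm_sq (z : ℂ) : Δ (fun z : ℂ => ‖z‖ ^ 2) z = 4 := by
  have h : (fun z : ℂ => ‖z‖ ^ 2) =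
      Complex.reCLM ∘ fun z : ℂ => z ^ (0 + 1) * conj z ^ (0 + 1) := by
    ext z
    simp only [zero_add, pow_one, Function.comp_apply, Complex.mul_conj, Complex.normSq_eq_norm_sq,
      Complex.reCLM_apply, Complex.ofReal_re]
  rw [h, ContDiffAt.laplacian_CLM_comp_left]
  · simp only [Function.comp, laplacian_monomial]; simp
  · exact (((contDiff_id).pow _).mul ((Complex.conjCLE.contDiff).pow _)).contDiffAt

lemma le_of_neg_le_laplacian {φ : ℂ → ℝ} {M : ℝ} (hc : ContinuousOn φ (closedBall 0 1))
    (hφ : ∀ z ∈ ball (0 : ℂ) 1, ContDiffAt ℝ 2 φ z) (h0 : ∀ z ∈ sphere (0 : ℂ) 1, φ z = 0)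
    (hM0 : 0 ≤ M) (hM : ∀ z ∈ ball (0 : ℂ) 1, -M ≤ Δ φ z) :
    ∀ z ∈ closedBall (0 : ℂ) 1, φ z ≤ M / 4 := by
  have hsq : ContDiff ℝ 2 (fun z : ℂ => ‖z‖ ^ 2) := contDiff_norm_sq ℝ
  -- the strict inequality `Δ ψ > 0` for `ψ = φ + (M / 4 + δ) (|z|² - 1)` excludes interior maxima
  have key : ∀ δ > 0, ∀ z ∈ closedBall (0 : ℂ) 1, φ z ≤ M / 4 + δ := by
    intro δ hδ z hz
    set ψ : ℂ → ℝ := φ + (M / 4 + δ) • fun z : ℂ => ‖z‖ ^ 2 with hψ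
    have hψc : ContinuousOn ψ (closedBall 0 1) :=
      hc.add ((hsq.continuous.const_smul _).continuousOn)
    obtain ⟨m, hm, hmax⟩ := (isCompact_closedBall (0 : ℂ) 1).exists_isMaxOn ⟨z, hz⟩ hψc
    have hms : m ∈ sphere (0 : ℂ) 1 := by
      by_contra hns
      have hmb : m ∈ ball (0 : ℂ) 1 := by
        simp only [mem_closedBall, mem_sphere, mem_ball] at hm hns ⊢
        exact lt_of_le_of_ne hm hns
      have hl : IsLocalMax ψ m := hmax.isLocalMax
        (mem_of_superset (isOpen_ball.mem_nhds hmb) ball_subset_closedBall)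
      have h1 : ContDiffAt ℝ 2 ((M / 4 + δ) • fun z : ℂ => ‖z‖ ^ 2) m :=
        (hsq.const_smul (M / 4 + δ)).contDiffAt
      have h2 : Δ ψ m ≤ 0 := laplacian_nonpos_of_isLocalMax ((hφ m hmb).add h1) hl
      rw [hψ, (hφ m hmb).laplacian_add h1, laplacian_smul _ hsq.contDiffAt, laplacian_norm_sq,
        smul_eq_mul] at h2
      linarith [hM m hmb]
    have h3 : ψ z ≤ ψ m := hmax hz
    have hm1 : ‖m‖ = 1 := by simpa using hms
    simp only [hψ, Pi.add_apply, Pi.smul_apply, smul_eq_mul, h0 m hms, hm1] at h3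
    nlinarith [mul_nonneg (by positivity : 0 ≤ M / 4 + δ) (sq_nonneg ‖z‖)]
  exact fun z hz => le_of_forall_pos_le_add fun δ hδ => key δ hδ z hz

/-- The maximum principle: a function that vanishes on the unit circle is bounded by a quarter of a
bound for its Laplacian, with equality for multiples of `1 - |z|²`. -/
lemma abs_le_of_abs_laplacian_le {φ : ℂ → ℝ} {M : ℝ} (hc : ContinuousOn φ (closedBall 0 1))
    (hφ : ∀ z ∈ ball (0 : ℂ) 1, ContDiffAt ℝ 2 φ z) (h0 : ∀ z ∈ sphere (0 : ℂ) 1, φ z = 0)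
    (hM0 : 0 ≤ M) (hM : ∀ z ∈ ball (0 : ℂ) 1, |Δ φ z| ≤ M) {z : ℂ}
    (hz : z ∈ closedBall (0 : ℂ) 1) : |φ z| ≤ M / 4 := by
  refine abs_le.2 ⟨?_, le_of_neg_le_laplacian hc hφ h0 hM0
    (fun z hz => (abs_le.1 (hM z hz)).1) z hz⟩
  have := le_of_neg_le_laplacian (φ := -φ) hc.neg (fun z hz => (hφ z hz).neg)
    (fun z hz => by simp [h0 z hz]) hM0 (fun z hz => by
      rw [laplacian_neg]; simpa using (abs_le.1 (hM z hz)).2) z hz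
  simp only [Pi.neg_apply] at this
  linarith

/-! ### Integrability of the logarithmic kernel -/

/-- On `[0, r]` the logarithm is dominated by an inverse square root.  This includes `t = 0`,
where both sides are zero by convention. -/
lemma abs_log_le_rpow {t r : ℝ} (ht : 0 ≤ t) (htr : t ≤ r) :
    |Real.log t| ≤ (2 * r + 2) * t ^ (-(1 / 2) : ℝ) := by
  rcases ht.eq_or_lt with rfl | ht
  · simp
  have h1 := Real.log_le_rpow_div ht.le (ε := 1 / 2) (by norm_num)
  have h2 := Real.log_le_rpow_div (inv_pos.2 ht).le (ε := 1 / 2) (by norm_num)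
  rw [Real.log_inv, Real.inv_rpow ht.le, ← Real.rpow_neg ht.le] at h2
  have h3 : t ^ (1 / 2 : ℝ) = t * t ^ (-(1 / 2) : ℝ) := by
    nth_rw 2 [← Real.rpow_one t]
    rw [← Real.rpow_add ht]; norm_num
  have h4 : t * t ^ (-(1 / 2) : ℝ) ≤ r * t ^ (-(1 / 2) : ℝ) := by gcongr
  have h5 : 0 ≤ t ^ (-(1 / 2) : ℝ) := by positivity
  rw [h3] at h1
  have h6 : 0 ≤ t * t ^ (-(1 / 2) : ℝ) := by positivity
  refine abs_le.2 ⟨?_, ?_⟩ <;> linarith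

section kernel
variable {E : Type*} [NormedAddCommGroup E] [NormedSpace ℝ E] [FiniteDimensional ℝ E]
  [MeasurableSpace E] [BorelSpace E] {μ : Measure E} [μ.IsAddHaarMeasure]

lemma integrableOn_log_norm (h2 : Module.finrank ℝ E = 2) (r : ℝ) :
    IntegrableOn (fun x : E => Real.log ‖x‖) (ball 0 r) μ := by
  refine integrableOn_ball_of_norm_le_rpow (C := 2 * r + 2) (α := 1 / 2) (by omega)
    (by rw [h2]; norm_num) ?_ (Real.measurable_log.comp measurable_norm).aestronglyMeasurable
  filter_upwards [ae_restrict_mem measurableSet_ball] with x hx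
  exact abs_log_le_rpow (norm_nonneg x) (by simpa using (mem_ball_zero_iff.1 hx).le)

lemma integrableOn_log_norm_sq (h2 : Module.finrank ℝ E = 2) (r : ℝ) :
    IntegrableOn (fun x : E => Real.log ‖x‖ ^ 2) (ball 0 r) μ := by
  refine integrableOn_ball_of_norm_le_rpow (C := (2 * r + 2) ^ 2) (α := 1) (by omega)
    (by rw [h2]; norm_num) ?_
    ((Real.measurable_log.comp measurable_norm).pow_const 2).aestronglyMeasurable
  filter_upwards [ae_restrict_mem measurableSet_ball] with x hx
  have h := abs_log_le_rpow (norm_nonneg x) (by simpa using (mem_ball_zero_iff.1 hx).le)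
  have h3 : ‖x‖ ^ (-1 : ℝ) = (‖x‖ ^ (-(1 / 2) : ℝ)) ^ 2 := by
    rw [← Real.rpow_natCast, ← Real.rpow_mul (norm_nonneg _)]; norm_num
  rw [norm_pow, Real.norm_eq_abs, h3, ← mul_pow]
  exact pow_le_pow_left₀ (abs_nonneg _) h 2

lemma integrableOn_inv_norm (h2 : Module.finrank ℝ E = 2) (r : ℝ) :
    IntegrableOn (fun x : E => ‖x‖⁻¹) (ball 0 r) μ := by
  refine integrableOn_ball_of_norm_le_rpow (C := 1) (α := 1) (by omega)
    (by rw [h2]; norm_num) (Eventually.of_forall fun x => ?_) (by fun_prop)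
  simp [Real.rpow_neg_one]

end kernel

/-! ### The Poisson problem with polynomial right-hand side -/

/-- `q` is a `C²` solution of `Δ q = p` in the unit disc that vanishes on the unit circle, and it
satisfies the Green representation formula at the centre. -/
structure IsPoissonSolution (p q : ℂ → ℂ) : Prop where
  contDiff : ContDiff ℝ 2 q
  eq_zero : ∀ z ∈ sphere (0 : ℂ) 1, q z = 0
  laplacian_eq : ∀ z, Δ q z = p z
  integral_eq : ∫ z in ball (0 : ℂ) 1, Real.log ‖z‖ * p z = 2 * Real.pi * q 0

lemma IsPoissonSolution.continuous {p q : ℂ → ℂ} (h : IsPoissonSolution p q) : Continuous p := by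
  have h1 : p = fun z => Δ q z := funext fun z => (h.laplacian_eq z).symm
  rw [h1, laplacian_eq_iteratedFDeriv_complexPlane]
  have h2 := h.contDiff.continuous_iteratedFDeriv (m := 2) le_rfl
  exact ((ContinuousMultilinearMap.apply ℝ (fun _ : Fin 2 => ℂ) ℂ ![1, 1]).continuous.comp h2).add
    ((ContinuousMultilinearMap.apply ℝ (fun _ : Fin 2 => ℂ) ℂ
      ![Complex.I, Complex.I]).continuous.comp h2)

lemma integrableOn_log_norm_mul {p : ℂ → ℂ} (hp : Continuous p) :
    IntegrableOn (fun z : ℂ => Real.log ‖z‖ * p z) (ball 0 1) := by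
  have h := (integrableOn_log_norm (E := ℂ) (μ := volume) Complex.finrank_real_complex 1)
  obtain ⟨C, hC⟩ := (isCompact_closedBall (0 : ℂ) 1).exists_bound_of_continuousOn hp.continuousOn
  refine Integrable.mul_bdd (c := C) (f := fun z : ℂ => (Real.log ‖z‖ : ℂ)) h.ofReal
    hp.aestronglyMeasurable.restrict ?_
  filter_upwards [ae_restrict_mem measurableSet_ball] with x hx
  exact hC x (ball_subset_closedBall hx)

lemma IsPoissonSolution.add {p q p' q' : ℂ → ℂ} (h : IsPoissonSolution p q)
    (h' : IsPoissonSolution p' q') : IsPoissonSolution (p + p') (q + q') where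
  contDiff := h.contDiff.add h'.contDiff
  eq_zero z hz := by simp [h.eq_zero z hz, h'.eq_zero z hz]
  laplacian_eq z := by
    rw [h.contDiff.contDiffAt.laplacian_add h'.contDiff.contDiffAt, h.laplacian_eq, h'.laplacian_eq,
      Pi.add_apply]
  integral_eq := by
    simp only [Pi.add_apply, mul_add]
    rw [integral_add (integrableOn_log_norm_mul h.continuous)
      (integrableOn_log_norm_mul h'.continuous), h.integral_eq, h'.integral_eq]

lemma IsPoissonSolution.smul {p q : ℂ → ℂ} (h : IsPoissonSolution p q) (c : ℂ) :
    IsPoissonSolution (c • p) (c • q) where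
  contDiff := h.contDiff.const_smul c
  eq_zero z hz := by simp [h.eq_zero z hz]
  laplacian_eq z := by
    rw [laplacian_smul c h.contDiff.contDiffAt, h.laplacian_eq, Pi.smul_apply]
  integral_eq := by
    simp only [Pi.smul_apply, smul_eq_mul, mul_left_comm _ c]
    rw [integral_const_mul, h.integral_eq]

lemma isPoissonSolution_zero : IsPoissonSolution 0 0 where
  contDiff := contDiff_const
  eq_zero z _ := rfl
  laplacian_eq z := by
    have : (0 : ℂ → ℂ) = fun _ => 0 := rfl
    rw [this, laplacian_const]
    rfl
  integral_eq := by simp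

lemma integral_pow_mul_log (n : ℕ) :
    ∫ r in (0 : ℝ)..1, r ^ (n + 1) * Real.log r = -1 / ((n : ℝ) + 2) ^ 2 := by
  have hc : ∀ k : ℕ, Continuous fun r : ℝ => r ^ (k + 1) * Real.log r := fun k => by
    have : (fun r : ℝ => r ^ (k + 1) * Real.log r) = fun r => r ^ k * (r * Real.log r) := by
      ext r; ring
    rw [this]
    exact (continuous_pow k).mul Real.continuous_mul_log
  have hn : (n : ℝ) + 2 ≠ 0 := by positivity
  rw [intervalIntegral.integral_eq_sub_of_hasDerivAt_of_le zero_le_one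
    (f := fun r => r ^ (n + 2) * Real.log r / (n + 2) - r ^ (n + 2) / ((n : ℝ) + 2) ^ 2)]
  · simp [neg_div]
  · exact (((hc (n + 1)).div_const _).sub ((continuous_pow _).div_const _)).continuousOn
  · intro r hr
    have h1 := (((hasDerivAt_pow (n + 2) r).mul (Real.hasDerivAt_log hr.1.ne')).div_const
      ((n : ℝ) + 2)).sub ((hasDerivAt_pow (n + 2) r).div_const (((n : ℝ) + 2) ^ 2))
    refine h1.congr_deriv ?_
    have := hr.1.ne'
    push_cast
    field_simp
    ring
  · exact (hc n).intervalIntegrable _ _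

lemma integral_exp_int_mul {k : ℤ} (hk : k ≠ 0) :
    ∫ θ in Ioo (-Real.pi) Real.pi, Complex.exp (k * Complex.I * θ) = 0 := by
  have hc : (k : ℂ) * Complex.I ≠ 0 := mul_ne_zero (by exact_mod_cast hk) Complex.I_ne_zero
  rw [← integral_Ioc_eq_integral_Ioo, ← intervalIntegral.integral_of_le (by linarith [Real.pi_pos]),
    integral_exp_mul_complex hc, div_eq_zero_iff]
  left
  rw [sub_eq_zero, Complex.exp_eq_exp_iff_exists_int]
  exact ⟨k, by push_cast; ring⟩

/-- In polar coordinates the angular integral vanishes unless `a = b`. -/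
lemma integral_log_norm_mul_monomial (a b : ℕ) :
    ∫ z in ball (0 : ℂ) 1, Real.log ‖z‖ * (z ^ a * conj z ^ b) =
      if a = b then -(2 * (Real.pi : ℂ)) / (2 * ((a : ℂ) + 1)) ^ 2 else 0 := by
  rw [← integral_indicator measurableSet_ball, ← Complex.integral_comp_polarCoord_symm]
  have h1 : ∀ p ∈ polarCoord.target,
      p.1 • (ball (0 : ℂ) 1).indicator (fun z : ℂ => Real.log ‖z‖ * (z ^ a * conj z ^ b))
        (Complex.polarCoord.symm p) =
      (((Ioo (0 : ℝ) 1).indicator (fun r : ℝ => r ^ (a + b + 1) * Real.log r) p.1 : ℝ) : ℂ) *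
        Complex.exp (((a - b : ℤ) : ℂ) * Complex.I * p.2) := by
    rintro ⟨r, θ⟩ ⟨hr, hθ⟩
    have hr : 0 < r := hr
    have he : Complex.polarCoord.symm (r, θ) = r * Complex.exp (θ * Complex.I) := by
      rw [Complex.polarCoord_symm_apply, Complex.exp_mul_I]; simp
    have hn : ‖Complex.polarCoord.symm (r, θ)‖ = r := by
      rw [Complex.norm_polarCoord_symm]; exact abs_of_pos hr
    by_cases h : r < 1
    · rw [indicator_of_mem (by rw [mem_ball_zero_iff, hn]; exact h),
        indicator_of_mem (show r ∈ Ioo (0 : ℝ) 1 from ⟨hr, h⟩), hn, he]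
      have hce : conj (r * Complex.exp (θ * Complex.I)) = r * Complex.exp (-(θ * Complex.I)) := by
        rw [map_mul, Complex.conj_ofReal, ← Complex.exp_conj, map_mul, Complex.conj_ofReal,
          Complex.conj_I, mul_neg]
      have hexp : Complex.exp (((a - b : ℤ) : ℂ) * Complex.I * θ) =
          Complex.exp (θ * Complex.I) ^ a * Complex.exp (-(θ * Complex.I)) ^ b := by
        rw [← Complex.exp_nat_mul, ← Complex.exp_nat_mul, ← Complex.exp_add]
        congr 1
        push_cast
        ring
      rw [hce, hexp, Complex.real_smul]
      push_cast
      ring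
    · rw [indicator_of_notMem (by rw [mem_ball_zero_iff, hn]; exact h),
        indicator_of_notMem (show r ∉ Ioo (0 : ℝ) 1 from fun hm => h hm.2)]
      simp
  rw [setIntegral_congr_fun (polarCoord.open_target.measurableSet) h1, polarCoord_target,
    Measure.volume_eq_prod,
    setIntegral_prod_mul
      (fun r : ℝ => (((Ioo (0 : ℝ) 1).indicator
        (fun r : ℝ => r ^ (a + b + 1) * Real.log r) r : ℝ) : ℂ))
      (fun θ : ℝ => Complex.exp (((a - b : ℤ) : ℂ) * Complex.I * θ))]
  have h2 : ∫ r in Ioi (0 : ℝ),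
      (((Ioo (0 : ℝ) 1).indicator (fun r : ℝ => r ^ (a + b + 1) * Real.log r) r : ℝ) : ℂ) =
      ((-1 / (((a + b : ℕ) : ℝ) + 2) ^ 2 : ℝ) : ℂ) := by
    rw [integral_complex_ofReal, setIntegral_indicator measurableSet_Ioo,
      inter_eq_right.2 Ioo_subset_Ioi_self, ← integral_Ioc_eq_integral_Ioo,
      ← intervalIntegral.integral_of_le zero_le_one, integral_pow_mul_log]
  rw [h2]
  split_ifs with hab
  · subst hab
    have : (volume.real (Ioo (-Real.pi) Real.pi)) = 2 * Real.pi := by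
      rw [Real.volume_real_Ioo_of_le (by linarith [Real.pi_pos])]; ring
    simp [this]
    have : (a : ℂ) + 1 ≠ 0 := by exact_mod_cast Nat.succ_ne_zero a
    have h3 : (a : ℂ) + a + 2 = 2 * (a + 1) := by ring
    rw [h3]
    field_simp
  · rw [integral_exp_int_mul (by omega), mul_zero]

/-- The boundary correction `z ^ (a - b)` (or its conjugate) is harmonic and agrees with
`z ^ (a + 1) * conj z ^ (b + 1)` on the unit circle. -/
lemma exists_isPoissonSolution_monomial (a b : ℕ) :
    ∃ q, IsPoissonSolution (fun z => z ^ a * conj z ^ b) q := by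
  obtain ⟨h, hh, hΔ, hs, h0⟩ : ∃ h : ℂ → ℂ, ContDiff ℝ 2 h ∧ (∀ z, Δ h z = 0) ∧
      (∀ z ∈ sphere (0 : ℂ) 1, z ^ (a + 1) * conj z ^ (b + 1) = h z) ∧
      h 0 = if a = b then 1 else 0 := by
    have hunit : ∀ z ∈ sphere (0 : ℂ) 1, z * conj z = 1 := fun z hz => by
      rw [Complex.mul_conj, Complex.normSq_eq_norm_sq]
      simp [mem_sphere_zero_iff_norm.1 hz]
    have hpow : ∀ k : ℕ, HarmonicOnNhd (fun z : ℂ => z ^ k) univ := fun k z _ =>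
      (analyticAt_id.pow k).harmonicAt
    rcases le_total b a with hab | hab
    · obtain ⟨k, rfl⟩ := Nat.exists_eq_add_of_le hab
      refine ⟨fun z => z ^ k, contDiff_id.pow k, fun z => ?_, fun z hz => ?_, ?_⟩
      · exact (hpow k z (mem_univ _)).2.eq_of_nhds
      · calc z ^ (b + k + 1) * conj z ^ (b + 1) = (z * conj z) ^ (b + 1) * z ^ k := by ring
          _ = z ^ k := by rw [hunit z hz]; simp
      · simp [zero_pow_eq]
    · obtain ⟨k, rfl⟩ := Nat.exists_eq_add_of_le hab
      have hc : (fun z : ℂ => conj z ^ k) = Complex.conjCLE ∘ fun z : ℂ => z ^ k := by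
        ext z; simp
      refine ⟨fun z => conj z ^ k, Complex.conjCLE.contDiff.pow k, fun z => ?_,
        fun z hz => ?_, ?_⟩
      · rw [hc, laplacian_CLE_comp_left, Function.comp, (hpow k z (mem_univ _)).2.eq_of_nhds]
        simp
      · calc z ^ (a + 1) * conj z ^ (a + k + 1) = (z * conj z) ^ (a + 1) * conj z ^ k := by ring
          _ = conj z ^ k := by rw [hunit z hz]; simp
      · simp [zero_pow_eq]
  have ha : (a : ℂ) + 1 ≠ 0 := by exact_mod_cast Nat.succ_ne_zero a
  have hb : (b : ℂ) + 1 ≠ 0 := by exact_mod_cast Nat.succ_ne_zero b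
  have hm : ContDiff ℝ 2 fun z : ℂ => z ^ (a + 1) * conj z ^ (b + 1) :=
    (contDiff_id.pow _).mul (Complex.conjCLE.contDiff.pow _)
  have hs' : ContDiff ℝ 2 ((fun z : ℂ => z ^ (a + 1) * conj z ^ (b + 1)) - h) := hm.sub hh
  set c : ℂ := (4 * ((a + 1) * (b + 1)))⁻¹
  refine ⟨c • ((fun z : ℂ => z ^ (a + 1) * conj z ^ (b + 1)) - h),
    hs'.const_smul c, fun z hz => ?_, fun z => ?_, ?_⟩
  · simp [hs z hz]
  · rw [laplacian_smul c hs'.contDiffAt, hm.contDiffAt.laplacian_sub hh.contDiffAt,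
      laplacian_monomial, hΔ]
    simp only [c, smul_eq_mul, sub_zero]
    field_simp
  · rw [integral_log_norm_mul_monomial]
    simp only [Pi.smul_apply, Pi.sub_apply, h0, smul_eq_mul, c]
    split_ifs with hab
    · subst hab
      simp
      field_simp
      norm_num
    · simp

/-- Combinations of the monomials `z ^ a * conj z ^ b` are uniformly dense, so that every
continuous function is nearly the Laplacian of a function that vanishes on the circle. -/
lemma exists_laplacian_approx {F : ℂ → ℝ} (hF : ContinuousOn F (closedBall 0 1)) {ε : ℝ}
    (hε : 0 < ε) : ∃ ψ : ℂ → ℝ, ContDiff ℝ 2 ψ ∧ (∀ z ∈ sphere (0 : ℂ) 1, ψ z = 0) ∧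
      Continuous (Δ ψ) ∧ (∀ z ∈ closedBall (0 : ℂ) 1, |F z - Δ ψ z| ≤ ε) ∧
      ∫ z in ball (0 : ℂ) 1, Real.log ‖z‖ * Δ ψ z = 2 * Real.pi * ψ 0 := by
  obtain ⟨p, q, hpq, hp⟩ : ∃ p q : ℂ → ℂ, IsPoissonSolution p q ∧
      ∀ z ∈ closedBall (0 : ℂ) 1, ‖(F z : ℂ) - p z‖ ≤ ε := by
    have : CompactSpace (closedBall (0 : ℂ) 1) :=
      isCompact_iff_compactSpace.1 (isCompact_closedBall _ _)
    set X : C(closedBall (0 : ℂ) 1, ℂ) := .restrict _ (.id ℂ)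
    have hspan : ∀ f ∈ StarAlgebra.adjoin ℂ {X}, ∃ p q : ℂ → ℂ, IsPoissonSolution p q ∧
        ∀ z : closedBall (0 : ℂ) 1, f z = p z := by
      intro f hf
      have hf' : f ∈ Submodule.span ℂ
          (Submonoid.closure {X, star X} : Set C(closedBall (0 : ℂ) 1, ℂ)) := by
        rw [← Algebra.adjoin_eq_span]
        have : f ∈ (StarAlgebra.adjoin ℂ {X}).toSubalgebra := hf
        rw [StarAlgebra.adjoin_toSubalgebra] at this
        simpa [star_singleton, pair_comm] using this
      clear hf
      induction hf' using Submodule.span_induction with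
      | mem f h =>
        obtain ⟨a, b, rfl⟩ := Submonoid.mem_closure_pair _ _ _ |>.1 h
        obtain ⟨q, hq⟩ := exists_isPoissonSolution_monomial a b
        exact ⟨_, q, hq, fun z => rfl⟩
      | zero => exact ⟨0, 0, isPoissonSolution_zero, fun z => rfl⟩
      | add f g _ _ hf hg =>
        obtain ⟨p, q, h, h1⟩ := hf
        obtain ⟨p', q', h', h1'⟩ := hg
        exact ⟨_, _, h.add h', fun z => by simp [h1, h1']⟩
      | smul c f _ hf =>
        obtain ⟨p, q, h, h1⟩ := hf
        exact ⟨_, _, h.smul c, fun z => by simp [h1]⟩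
    have hdense : (StarAlgebra.adjoin ℂ {X}).topologicalClosure = ⊤ :=
      ContinuousMap.elemental_id_eq_top _
    set G : C(closedBall (0 : ℂ) 1, ℂ) :=
      ⟨fun z => (F z : ℂ), Complex.continuous_ofReal.comp hF.domRestrict⟩
    have hG : G ∈ (StarAlgebra.adjoin ℂ {X}).topologicalClosure := hdense ▸ trivial
    have hG' : G ∈ closure (StarAlgebra.adjoin ℂ {X} : Set C(closedBall (0 : ℂ) 1, ℂ)) := hG
    obtain ⟨f, hf, hfG⟩ := Metric.mem_closure_iff.1 hG' ε hε
    obtain ⟨p, q, h, h1⟩ := hspan f hf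
    refine ⟨p, q, h, fun z hz => ?_⟩
    rw [← h1 ⟨z, hz⟩]
    exact (ContinuousMap.norm_coe_le_norm (G - f) ⟨z, hz⟩).trans
      (by rw [← dist_eq_norm]; exact hfG.le)
  have hΔ : Δ (Complex.reCLM ∘ q) = fun z => (p z).re := by
    ext z
    rw [hpq.contDiff.contDiffAt.laplacian_CLM_comp_left, Function.comp, hpq.laplacian_eq]
    rfl
  refine ⟨Complex.reCLM ∘ q, Complex.reCLM.contDiff.comp hpq.contDiff, fun z hz => ?_, ?_,
    fun z hz => ?_, ?_⟩
  · simp [hpq.eq_zero z hz]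
  · rw [hΔ]; exact Complex.continuous_re.comp hpq.continuous
  · rw [hΔ]
    refine le_trans ?_ (hp z hz)
    simpa using Complex.abs_re_le_norm ((F z : ℂ) - p z)
  · rw [hΔ]
    have h := integral_re (integrableOn_log_norm_mul hpq.continuous)
    rw [hpq.integral_eq] at h
    simp only [RCLike.re_to_complex, Complex.re_ofReal_mul] at h
    rw [h]
    have : (2 * Real.pi * q 0 : ℂ) = ((2 * Real.pi : ℝ) : ℂ) * q 0 := by push_cast; ring
    rw [this, Complex.re_ofReal_mul]
    rfl

/-! ### The Green representation formula in the disc -/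

/-- The representation formula at the centre: it holds for polynomials, and a function with
small Laplacian is small by the maximum principle. -/
lemma integral_log_norm_mul_laplacian {φ : ℂ → ℝ} (hφ : ContDiffOn ℝ 2 φ (closedBall 0 1))
    (h0 : ∀ z ∈ sphere (0 : ℂ) 1, φ z = 0) :
    ∫ z in ball (0 : ℂ) 1, Real.log ‖z‖ * Δ φ z = 2 * Real.pi * φ 0 := by
  obtain ⟨F, hF, hFφ⟩ := exists_continuousOn_eq_laplacian hφ
  have hat : ∀ z ∈ ball (0 : ℂ) 1, ContDiffAt ℝ 2 φ z := fun z hz =>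
    hφ.contDiffAt (mem_of_superset (isOpen_ball.mem_nhds hz) ball_subset_closedBall)
  have hlog := integrableOn_log_norm (E := ℂ) (μ := volume) Complex.finrank_real_complex 1
  have hint : ∀ G : ℂ → ℝ, ContinuousOn G (closedBall 0 1) →
      IntegrableOn (fun z : ℂ => Real.log ‖z‖ * G z) (ball 0 1) := by
    intro G hG
    obtain ⟨C, hC⟩ := (isCompact_closedBall (0 : ℂ) 1).exists_bound_of_continuousOn hG
    refine Integrable.mul_bdd (c := C) hlog
      ((hG.mono ball_subset_closedBall).aestronglyMeasurable measurableSet_ball) ?_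
    filter_upwards [ae_restrict_mem measurableSet_ball] with x hx
    exact hC x (ball_subset_closedBall hx)
  set A : ℝ := ∫ z in ball (0 : ℂ) 1, |Real.log ‖z‖|
  have hA : 0 ≤ A := integral_nonneg fun z => abs_nonneg _
  have key : ∀ ε > 0,
      |(∫ z in ball (0 : ℂ) 1, Real.log ‖z‖ * Δ φ z) - 2 * Real.pi * φ 0| ≤
        (A + 2 * Real.pi / 4) * ε := by
    intro ε hε
    obtain ⟨ψ, hψ, hψ0, hψc, hψF, hψi⟩ := exists_laplacian_approx hF hε
    have h1 : |φ 0 - ψ 0| ≤ ε / 4 := by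
      refine abs_le_of_abs_laplacian_le (φ := φ - ψ)
        (hφ.continuousOn.sub hψ.continuous.continuousOn)
        (fun z hz => (hat z hz).sub hψ.contDiffAt) (fun z hz => ?_) hε.le (fun z hz => ?_) (by simp)
      · simp [h0 z hz, hψ0 z hz]
      · rw [(hat z hz).laplacian_sub hψ.contDiffAt, ← hFφ z hz]
        exact hψF z (ball_subset_closedBall hz)
    have h2 : |∫ z in ball (0 : ℂ) 1, Real.log ‖z‖ * (F z - Δ ψ z)| ≤ A * ε := by
      rw [← Real.norm_eq_abs, ← integral_mul_const]
      refine norm_integral_le_of_norm_le (hlog.abs.mul_const ε) ?_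
      filter_upwards [ae_restrict_mem measurableSet_ball] with z hz
      rw [norm_mul, Real.norm_eq_abs, Real.norm_eq_abs]
      exact mul_le_mul_of_nonneg_left (hψF z (ball_subset_closedBall hz)) (abs_nonneg _)
    have h3 : ∫ z in ball (0 : ℂ) 1, Real.log ‖z‖ * Δ φ z =
        (∫ z in ball (0 : ℂ) 1, Real.log ‖z‖ * (F z - Δ ψ z)) + 2 * Real.pi * ψ 0 := by
      rw [← hψi, ← integral_add (hint (fun z => F z - Δ ψ z) (hF.sub hψc.continuousOn))
        (hint _ hψc.continuousOn)]
      refine setIntegral_congr_fun measurableSet_ball fun z hz => ?_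
      simp only [hFφ z hz]
      ring
    rw [h3]
    have h4 : (∫ z in ball (0 : ℂ) 1, Real.log ‖z‖ * (F z - Δ ψ z)) + 2 * Real.pi * ψ 0 -
        2 * Real.pi * φ 0 = (∫ z in ball (0 : ℂ) 1, Real.log ‖z‖ * (F z - Δ ψ z)) -
        2 * Real.pi * (φ 0 - ψ 0) := by ring
    rw [h4]
    refine (abs_sub _ _).trans ?_
    rw [abs_mul, abs_of_pos Real.two_pi_pos]
    have := mul_le_mul_of_nonneg_left h1 Real.two_pi_pos.le
    linarith
  refine eq_of_abs_sub_nonpos (le_of_forall_pos_le_add fun δ hδ => ?_)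
  have hB : 0 < A + 2 * Real.pi / 4 := by positivity
  have := key (δ / (A + 2 * Real.pi / 4)) (by positivity)
  rwa [mul_div_cancel₀ _ hB.ne', ← zero_add δ] at this

/-- Conformal covariance of the Laplacian in the plane. -/
lemma laplacian_comp_analyticAt {φ : ℂ → ℝ} {h : ℂ → ℂ} {z : ℂ} (hh : AnalyticAt ℂ h z)
    (hφ : ContDiffAt ℝ 2 φ (h z)) : Δ (φ ∘ h) z = ‖deriv h z‖ ^ 2 * Δ φ (h z) := by
  have hd : ∀ᶠ w in 𝓝 z, HasFDerivAt h
      ((ContinuousLinearMap.toSpanSingleton ℂ (deriv h w)).restrictScalars ℝ) w := by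
    filter_upwards [hh.eventually_analyticAt] with w hw
    exact hw.differentiableAt.hasDerivAt.hasFDerivAt.restrictScalars ℝ
  have hφd : ∀ᶠ w in 𝓝 z, DifferentiableAt ℝ φ (h w) := by
    refine hh.continuousAt.eventually ?_
    filter_upwards [hφ.eventually (by simp)] with w hw using hw.differentiableAt (by norm_num)
  have hd1 : ∀ v : ℂ, (fun w => fderiv ℝ (φ ∘ h) w v) =ᶠ[𝓝 z]
      fun w => fderiv ℝ φ (h w) (deriv h w * v) := by
    intro v
    filter_upwards [hd, hφd] with w hw hφw
    rw [(hφw.hasFDerivAt.comp w hw).fderiv]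
    simp [mul_comm]
  have hcd : ContDiffAt ℝ 2 (φ ∘ h) z :=
    hφ.comp z ((hh.contDiffAt (n := 2)).restrict_scalars ℝ)
  have hdd : DifferentiableAt ℝ (fderiv ℝ (φ ∘ h)) z :=
    (hcd.fderiv_right (m := 1) (by norm_num)).differentiableAt (by norm_num)
  have hφdd : DifferentiableAt ℝ (fderiv ℝ φ) (h z) :=
    (hφ.fderiv_right (m := 1) (by norm_num)).differentiableAt (by norm_num)
  have hd2 : ∀ v : ℂ, fderiv ℝ (fderiv ℝ (φ ∘ h)) z v v =
      fderiv ℝ (fderiv ℝ φ) (h z) (deriv h z * v) (deriv h z * v) +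
        fderiv ℝ φ (h z) (deriv (deriv h) z * v * v) := by
    intro v
    have e1 : fderiv ℝ (fderiv ℝ (φ ∘ h)) z v v =
        fderiv ℝ (fun w => fderiv ℝ (φ ∘ h) w v) z v := by
      have := (hdd.hasFDerivAt.clm_apply (hasFDerivAt_const v z)).fderiv
      rw [this]
      simp
    have e2 : HasFDerivAt (fun w => fderiv ℝ φ (h w)) ((fderiv ℝ (fderiv ℝ φ) (h z)).comp
        ((ContinuousLinearMap.toSpanSingleton ℂ (deriv h z)).restrictScalars ℝ)) z :=
      hφdd.hasFDerivAt.comp z hd.self_of_nhds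
    have e3 : HasFDerivAt (fun w => deriv h w * v)
        ((ContinuousLinearMap.toSpanSingleton ℂ (deriv (deriv h) z * v)).restrictScalars ℝ) z :=
      (hh.deriv.differentiableAt.hasDerivAt.mul_const v).hasFDerivAt.restrictScalars ℝ
    rw [e1, (hd1 v).fderiv_eq, (e2.clm_apply e3).fderiv]
    simp [mul_comm, add_comm]
  rw [laplacian_eq_fderiv_fderiv, laplacian_eq_fderiv_fderiv, hd2, hd2]
  have hc : ∀ c : ℂ, c = c.re • (1 : ℂ) + c.im • Complex.I := fun c => by
    simp [Complex.re_add_im]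
  have hcI : ∀ c : ℂ, c * Complex.I = (-c.im) • (1 : ℂ) + c.re • Complex.I := fun c => by
    apply Complex.ext <;> simp
  have hneg : deriv (deriv h) z * Complex.I * Complex.I = -deriv (deriv h) z := by
    rw [mul_assoc, Complex.I_mul_I]; ring
  rw [hneg, mul_one, mul_one, mul_one, map_neg, hcI (deriv h z)]
  nth_rw 1 2 [hc (deriv h z)]
  rw [← Complex.normSq_eq_norm_sq, Complex.normSq_apply]
  simp only [map_add, map_smul, add_apply, smul_apply,
    smul_eq_mul]
  ring

/-- The involutive automorphism of the unit disc that exchanges `0` and `y`. -/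
noncomputable def discInvolution (y z : ℂ) : ℂ := (y - z) / (1 - conj y * z)

section involution
variable {y z : ℂ}

lemma one_sub_conj_mul_ne_zero (hy : ‖y‖ < 1) (hz : ‖z‖ ≤ 1) : 1 - conj y * z ≠ 0 := by
  intro h
  have h1 : ‖conj y * z‖ = 1 := by rw [← sub_eq_zero.1 h, norm_one]
  rw [norm_mul, RCLike.norm_conj] at h1
  nlinarith [norm_nonneg y, norm_nonneg z]

lemma one_sub_normSq_discInvolution (h : 1 - conj y * z ≠ 0) :
    1 - Complex.normSq (discInvolution y z) =
      (1 - Complex.normSq y) * (1 - Complex.normSq z) / Complex.normSq (1 - conj y * z) := by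
  have h' : Complex.normSq (1 - conj y * z) ≠ 0 := by simpa using h
  rw [discInvolution, Complex.normSq_div, eq_div_iff h', sub_mul, div_mul_cancel₀ _ h', one_mul]
  simp only [Complex.normSq_apply, Complex.sub_re, Complex.sub_im, Complex.mul_re, Complex.mul_im,
    Complex.conj_re, Complex.conj_im, Complex.one_re, Complex.one_im]
  ring

lemma norm_discInvolution_lt (hy : ‖y‖ < 1) (hz : ‖z‖ < 1) : ‖discInvolution y z‖ < 1 := by
  have h := one_sub_conj_mul_ne_zero hy hz.le
  have h1 := one_sub_normSq_discInvolution h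
  have h2 : 0 < Complex.normSq (1 - conj y * z) := Complex.normSq_pos.2 h
  simp only [Complex.normSq_eq_norm_sq] at h1 h2
  have h3 : 0 < (1 - ‖y‖ ^ 2) * (1 - ‖z‖ ^ 2) / ‖1 - conj y * z‖ ^ 2 :=
    div_pos (mul_pos (by nlinarith [norm_nonneg y]) (by nlinarith [norm_nonneg z])) h2
  nlinarith [norm_nonneg (discInvolution y z)]

lemma norm_discInvolution_eq (hy : ‖y‖ < 1) (hz : ‖z‖ = 1) : ‖discInvolution y z‖ = 1 := by
  have h := one_sub_normSq_discInvolution (one_sub_conj_mul_ne_zero hy hz.le)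
  simp only [Complex.normSq_eq_norm_sq, hz] at h
  norm_num at h
  have h1 : (‖discInvolution y z‖ - 1) * (‖discInvolution y z‖ + 1) = 0 := by linarith
  rcases mul_eq_zero.1 h1 with h2 | h2
  · linarith
  · linarith [norm_nonneg (discInvolution y z)]

lemma discInvolution_discInvolution (hy : ‖y‖ < 1) (hz : ‖z‖ ≤ 1) :
    discInvolution y (discInvolution y z) = z := by
  have h := one_sub_conj_mul_ne_zero hy hz
  have h2 : 1 - conj y * y ≠ 0 := one_sub_conj_mul_ne_zero hy hy.le
  have e1 : y - (y - z) / (1 - conj y * z) = z * (1 - conj y * y) / (1 - conj y * z) := by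
    rw [eq_div_iff h, sub_mul, div_mul_cancel₀ _ h]
    ring
  have e2 : 1 - conj y * ((y - z) / (1 - conj y * z)) = (1 - conj y * y) / (1 - conj y * z) := by
    rw [eq_div_iff h, sub_mul, mul_assoc, div_mul_cancel₀ _ h]
    ring
  rw [discInvolution, discInvolution, e1, e2, div_div_div_cancel_right₀ h, mul_div_assoc,
    div_self h2, mul_one]

lemma analyticAt_discInvolution (hy : ‖y‖ < 1) (hz : ‖z‖ ≤ 1) :
    AnalyticAt ℂ (discInvolution y) z :=
  (analyticAt_const.sub analyticAt_id).div
    (analyticAt_const.sub (analyticAt_const.mul analyticAt_id)) (one_sub_conj_mul_ne_zero hy hz)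

lemma image_discInvolution_ball (hy : ‖y‖ < 1) :
    discInvolution y '' ball 0 1 = ball 0 1 := by
  refine Subset.antisymm ?_ fun z hz => ?_
  · rintro _ ⟨z, hz, rfl⟩
    rw [mem_ball_zero_iff] at hz ⊢
    exact norm_discInvolution_lt hy hz
  · rw [mem_ball_zero_iff] at hz
    exact ⟨discInvolution y z, mem_ball_zero_iff.2 (norm_discInvolution_lt hy hz),
      discInvolution_discInvolution hy hz.le⟩

end involution

lemma det_toSpanSingleton_restrictScalars (c : ℂ) :
    ((ContinuousLinearMap.toSpanSingleton ℂ c).restrictScalars ℝ).det = ‖c‖ ^ 2 := by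
  have h := LinearMap.det_restrictScalars (R := ℝ) (S := ℂ) (f := LinearMap.toSpanSingleton ℂ ℂ c)
  have h2 : LinearMap.det (LinearMap.toSpanSingleton ℂ ℂ c) = c := by
    rw [LinearMap.det_ring]; simp
  rw [h2, Algebra.norm_complex_apply, Complex.normSq_eq_norm_sq] at h
  exact h

/-- The representation formula at any point `y` of the disc: transport the one at the centre by
the automorphism that exchanges `0` and `y`. -/
lemma integral_log_norm_discInvolution_mul_laplacian {φ : ℂ → ℝ}
    (hφ : ContDiffOn ℝ 2 φ (closedBall 0 1)) (h0 : ∀ z ∈ sphere (0 : ℂ) 1, φ z = 0) {y : ℂ}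
    (hy : ‖y‖ < 1) :
    ∫ z in ball (0 : ℂ) 1, Real.log ‖discInvolution y z‖ * Δ φ z = 2 * Real.pi * φ y := by
  have han : ∀ z ∈ closedBall (0 : ℂ) 1, AnalyticAt ℂ (discInvolution y) z := fun z hz =>
    analyticAt_discInvolution hy (mem_closedBall_zero_iff.1 hz)
  have hmaps : MapsTo (discInvolution y) (closedBall 0 1) (closedBall 0 1) := by
    intro z hz
    rw [mem_closedBall_zero_iff] at hz ⊢
    rcases hz.lt_or_eq with h | h
    · exact (norm_discInvolution_lt hy h).le
    · exact (norm_discInvolution_eq hy h).le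
  have hcomp : ContDiffOn ℝ 2 (φ ∘ discInvolution y) (closedBall 0 1) :=
    hφ.comp (fun z hz => (((han z hz).contDiffAt (n := 2)).restrict_scalars ℝ).contDiffWithinAt)
      hmaps
  have h := integral_log_norm_mul_laplacian hcomp (fun z hz => h0 _ (by
    rw [mem_sphere_zero_iff_norm] at hz ⊢
    exact norm_discInvolution_eq hy hz))
  have hy0 : discInvolution y 0 = y := by simp [discInvolution]
  rw [Function.comp, hy0] at h
  rw [← h]
  nth_rw 1 [← image_discInvolution_ball hy]
  rw [integral_image_eq_integral_abs_det_fderiv_smul volume measurableSet_ball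
    (f' := fun z => (ContinuousLinearMap.toSpanSingleton ℂ
      (deriv (discInvolution y) z)).restrictScalars ℝ)
    (fun z hz => ((han z (ball_subset_closedBall
      hz)).differentiableAt.hasDerivAt.hasFDerivAt.restrictScalars ℝ).hasFDerivWithinAt)
    (fun z hz w hw hzw => by
      rw [← discInvolution_discInvolution hy (mem_ball_zero_iff.1 hz).le, hzw,
        discInvolution_discInvolution hy (mem_ball_zero_iff.1 hw).le])]
  refine setIntegral_congr_fun measurableSet_ball fun z hz => ?_
  have hz' := mem_ball_zero_iff.1 hz
  have hat : ContDiffAt ℝ 2 φ (discInvolution y z) := hφ.contDiffAt (mem_of_superset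
    (isOpen_ball.mem_nhds (mem_ball_zero_iff.2 (norm_discInvolution_lt hy hz')))
    ball_subset_closedBall)
  simp only [det_toSpanSingleton_restrictScalars, smul_eq_mul,
    discInvolution_discInvolution hy hz'.le,
    laplacian_comp_analyticAt (han z (ball_subset_closedBall hz)) hat,
    abs_of_nonneg (sq_nonneg ‖deriv (discInvolution y) z‖)]
  ring

/-! ### Transfer to the Euclidean plane -/

/-- The standard isometry `x + i y ↦ (x, y)`. -/
noncomputable abbrev toPlane : ℂ ≃ₗᵢ[ℝ] Plane := Complex.orthonormalBasisOneI.repr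

lemma image_toPlane_ball : toPlane '' ball 0 1 = unitDisc := by
  rw [LinearIsometryEquiv.image_ball, map_zero]

lemma setIntegral_unitDisc_eq (f : Plane → ℝ) :
    ∫ x in unitDisc, f x = ∫ z in ball (0 : ℂ) 1, f (toPlane z) := by
  rw [← image_toPlane_ball, toPlane.measurePreserving.setIntegral_image_emb
    toPlane.toHomeomorph.measurableEmbedding]

/-- The square of `|y|` times the distance of `x` from the mirror image `y / |y|²` of `y` in the
unit circle.  In this form it is polynomial in `x` and `y`, with value `1` at `y = 0`. -/
noncomputable def mirrorDistSq (x y : Plane) : ℝ := 1 - 2 * inner ℝ x y + ‖x‖ ^ 2 * ‖y‖ ^ 2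

/-- The Green function of the unit disc, for `-Δ`: the fundamental solution with pole `y` minus its
reflection in the unit circle.  The value at `x = y` is immaterial. -/
noncomputable def greenKernel (x y : Plane) : ℝ :=
  -(1 / (2 * Real.pi)) * (Real.log ‖x - y‖ - Real.log (mirrorDistSq x y) / 2)

lemma integral_greenKernel_mul_laplacian {φ : Plane → ℝ}
    (hφ : ContDiffOn ℝ 2 φ (closedBall 0 1)) (h0 : ∀ z ∈ sphere (0 : Plane) 1, φ z = 0) {y : Plane}
    (hy : ‖y‖ < 1) :
    -∫ x in unitDisc, greenKernel x y * Δ φ x = φ y := by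
  obtain ⟨y, rfl⟩ := toPlane.surjective y
  rw [LinearIsometryEquiv.norm_map] at hy
  have h := integral_log_norm_discInvolution_mul_laplacian (φ := φ ∘ toPlane) (y := y)
    (hφ.comp toPlane.contDiff.contDiffOn (fun z hz => by
      rw [mem_closedBall_zero_iff] at hz ⊢
      rwa [LinearIsometryEquiv.norm_map]))
    (fun z hz => h0 _ (by
      rw [mem_sphere_zero_iff_norm] at hz ⊢
      rwa [LinearIsometryEquiv.norm_map])) hy
  rw [setIntegral_unitDisc_eq]
  have hker : ∀ᵐ z ∂(volume.restrict (ball (0 : ℂ) 1)),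
      greenKernel (toPlane z) (toPlane y) * Δ φ (toPlane z) =
      -(1 / (2 * Real.pi)) * (Real.log ‖discInvolution y z‖ * Δ (φ ∘ toPlane) z) := by
    filter_upwards [ae_restrict_mem measurableSet_ball,
      ae_restrict_of_ae (Measure.ae_ne volume y)] with z hz hzy
    have hz' := mem_ball_zero_iff.1 hz
    have hne := one_sub_conj_mul_ne_zero hy hz'.le
    have hm : mirrorDistSq (toPlane z) (toPlane y) = ‖1 - conj y * z‖ ^ 2 := by
      rw [mirrorDistSq, LinearIsometryEquiv.inner_map_map, LinearIsometryEquiv.norm_map,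
        LinearIsometryEquiv.norm_map, ← Complex.normSq_eq_norm_sq, ← Complex.normSq_eq_norm_sq,
        ← Complex.normSq_eq_norm_sq, Complex.inner]
      simp only [Complex.normSq_apply, Complex.sub_re, Complex.sub_im, Complex.mul_re,
        Complex.mul_im, Complex.conj_re, Complex.conj_im, Complex.one_re, Complex.one_im]
      ring
    rw [laplacian_comp_linearIsometryEquiv, greenKernel, ← map_sub, LinearIsometryEquiv.norm_map,
      hm, Real.log_pow, discInvolution, norm_div, norm_sub_rev z y,
      Real.log_div (norm_ne_zero_iff.2 (sub_ne_zero.2 hzy.symm)) (norm_ne_zero_iff.2 hne)]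
    push_cast
    ring
  rw [integral_congr_ae hker, integral_const_mul, h, Function.comp]
  field_simp

/-- Very weak solutions are unique, because Laplacians of functions that vanish on the circle are
uniformly dense. -/
lemma ae_eq_zero_of_integral_mul_laplacian_eq_zero {w : Plane → ℝ}
    (hw : MemLp w 2 (volume.restrict unitDisc))
    (h : ∀ φ : Plane → ℝ, ContDiff ℝ 2 φ → (∀ x ∈ sphere (0 : Plane) 1, φ x = 0) →
      ∫ x in unitDisc, w x * Δ φ x = 0) : w =ᵐ[volume.restrict unitDisc] 0 := by
  have : IsFiniteMeasure (volume.restrict unitDisc) :=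
    isFiniteMeasure_restrict.2 measure_ball_lt_top.ne
  have hw1 : IntegrableOn w unitDisc := hw.integrable (by norm_num)
  rw [EventuallyEq, ae_restrict_iff' measurableSet_ball]
  refine isOpen_ball.ae_eq_zero_of_integral_contDiff_smul_eq_zero hw1.locallyIntegrableOn
    fun g hg _ hgs => ?_
  have hgw : ∫ x, g x • w x = ∫ x in unitDisc, w x * g x := by
    rw [← setIntegral_eq_integral_of_forall_compl_eq_zero (s := unitDisc) fun x hx => by
      rw [image_eq_zero_of_notMem_tsupport (fun hx' => hx (hgs hx')), zero_smul]]
    simp only [smul_eq_mul, mul_comm]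
  rw [hgw]
  set A : ℝ := ∫ x in unitDisc, |w x|
  have hA : 0 ≤ A := integral_nonneg fun z => abs_nonneg _
  have key : ∀ ε > 0, |∫ x in unitDisc, w x * g x| ≤ A * ε := by
    intro ε hε
    obtain ⟨ψ, hψ, hψ0, hψc, hψF, -⟩ := exists_laplacian_approx (F := g ∘ toPlane)
      (hg.continuous.comp toPlane.continuous).continuousOn hε
    have hΔ : ∀ x, Δ (ψ ∘ toPlane.symm) x = Δ ψ (toPlane.symm x) := fun x =>
      laplacian_comp_linearIsometryEquiv toPlane.symm ψ x
    have h1 := h (ψ ∘ toPlane.symm) (hψ.comp toPlane.symm.contDiff) (fun x hx => hψ0 _ (by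
      rw [mem_sphere_zero_iff_norm] at hx ⊢
      rwa [LinearIsometryEquiv.norm_map]))
    have hbd : ∀ x ∈ unitDisc, |g x - Δ (ψ ∘ toPlane.symm) x| ≤ ε := by
      intro x hx
      have := hψF (toPlane.symm x) (by
        rw [mem_closedBall_zero_iff, LinearIsometryEquiv.norm_map]
        exact (mem_ball_zero_iff.1 hx).le)
      rwa [Function.comp, LinearIsometryEquiv.apply_symm_apply, ← hΔ] at this
    have hcont : Continuous (Δ (ψ ∘ toPlane.symm)) := by
      rw [funext hΔ]; exact hψc.comp toPlane.symm.continuous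
    have hint : ∀ G : Plane → ℝ, Continuous G → IntegrableOn (fun x => w x * G x) unitDisc := by
      intro G hG
      obtain ⟨C, hC⟩ :=
        (isCompact_closedBall (0 : Plane) 1).exists_bound_of_continuousOn hG.continuousOn
      refine Integrable.mul_bdd (c := C) hw1 hG.aestronglyMeasurable.restrict ?_
      filter_upwards [ae_restrict_mem measurableSet_ball] with x hx
      exact hC x (ball_subset_closedBall hx)
    rw [← sub_zero (∫ x in unitDisc, w x * g x), ← h1,
      ← integral_sub (hint _ hg.continuous) (hint _ hcont), ← Real.norm_eq_abs,
      ← integral_mul_const]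
    refine norm_integral_le_of_norm_le (hw1.abs.mul_const ε) ?_
    filter_upwards [ae_restrict_mem measurableSet_ball] with x hx
    rw [← mul_sub, norm_mul, Real.norm_eq_abs, Real.norm_eq_abs]
    exact mul_le_mul_of_nonneg_left (hbd x hx) (abs_nonneg _)
  refine abs_nonpos_iff.1 (le_of_forall_pos_le_add fun δ hδ => ?_)
  refine (key (δ / (A + 1)) (by positivity)).trans ?_
  rw [zero_add, mul_div_assoc', div_le_iff₀ (by positivity)]
  nlinarith

/-! ### Bounds for the Green function and its gradient -/

lemma mirrorDistSq_ge {x y : Plane} (hx : ‖x‖ ≤ 1) (hy : ‖y‖ ≤ 1 / 2) :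
    1 / 4 ≤ mirrorDistSq x y := by
  have h := real_inner_le_norm x y
  have h2 : ‖x‖ * ‖y‖ ≤ 1 / 2 := by nlinarith [norm_nonneg x, norm_nonneg y]
  rw [mirrorDistSq]
  nlinarith

lemma mirrorDistSq_le {x y : Plane} (hx : ‖x‖ ≤ 1) (hy : ‖y‖ ≤ 1 / 2) :
    mirrorDistSq x y ≤ 4 := by
  have h := neg_le_of_abs_le (abs_real_inner_le_norm x y)
  have h2 : ‖x‖ * ‖y‖ ≤ 1 / 2 := by nlinarith [norm_nonneg x, norm_nonneg y]
  have h3 : 0 ≤ ‖x‖ * ‖y‖ := by positivity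
  rw [mirrorDistSq]
  nlinarith

lemma one_div_two_pi_le_one : 1 / (2 * Real.pi) ≤ 1 := by
  rw [div_le_one Real.two_pi_pos]
  linarith [Real.pi_gt_three]

lemma abs_greenKernel_le {x y : Plane} (hx : ‖x‖ ≤ 1) (hy : ‖y‖ ≤ 1 / 2) :
    |greenKernel x y| ≤ |Real.log ‖x - y‖| + 1 := by
  have h4 : |Real.log (mirrorDistSq x y)| ≤ 2 := by
    have h1 := mirrorDistSq_ge hx hy
    have e : Real.log 4 ≤ 2 := by
      have : Real.log 4 = 2 * Real.log 2 := by
        rw [show (4 : ℝ) = 2 ^ 2 by norm_num, Real.log_pow]; norm_num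
      linarith [Real.log_two_lt_d9]
    have h2 := Real.log_le_log (by linarith) (mirrorDistSq_le hx hy)
    have h3 := Real.log_le_log (by norm_num) h1
    rw [one_div, Real.log_inv] at h3
    exact abs_le.2 ⟨by linarith, by linarith⟩
  rw [greenKernel, abs_mul, abs_neg, abs_of_pos (by positivity)]
  calc 1 / (2 * Real.pi) * |Real.log ‖x - y‖ - Real.log (mirrorDistSq x y) / 2|
      ≤ 1 * |Real.log ‖x - y‖ - Real.log (mirrorDistSq x y) / 2| := by
        gcongr; exact one_div_two_pi_le_one
    _ ≤ |Real.log ‖x - y‖| + |Real.log (mirrorDistSq x y) / 2| := by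
        rw [one_mul]; exact abs_sub _ _
    _ ≤ |Real.log ‖x - y‖| + 1 := by
        rw [abs_div, abs_two]; linarith

/-- The gradient of the Green function in its first variable, as a linear form. -/
noncomputable def greenKernelDeriv (x y : Plane) : Plane →L[ℝ] ℝ :=
  -(1 / (2 * Real.pi)) • ((‖x - y‖ ^ 2)⁻¹ • innerSL ℝ (x - y) -
    (mirrorDistSq x y)⁻¹ • (‖y‖ ^ 2 • innerSL ℝ x - innerSL ℝ y))

lemma hasFDerivAt_greenKernel {x y : Plane} (hxy : x ≠ y) (hm : mirrorDistSq x y ≠ 0) :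
    HasFDerivAt (fun x => greenKernel x y) (greenKernelDeriv x y) x := by
  have hn : ‖x - y‖ ^ 2 ≠ 0 := pow_ne_zero 2 (norm_ne_zero_iff.2 (sub_ne_zero.2 hxy))
  have h1 : HasFDerivAt (fun x => Real.log (‖x - y‖ ^ 2))
      ((‖x - y‖ ^ 2)⁻¹ • (2 • innerSL ℝ (x - y))) x := by
    have := (((hasFDerivAt_id (𝕜 := ℝ) x).sub_const y).norm_sq).log hn
    exact this
  have h2 : HasFDerivAt (fun x => mirrorDistSq x y)
      ((2 : ℝ) • (‖y‖ ^ 2 • innerSL ℝ x - innerSL ℝ y)) x := by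
    have e1 : HasFDerivAt (fun x : Plane => inner ℝ x y) (innerSL ℝ y) x := by
      have : (fun x : Plane => inner ℝ x y) = innerSL ℝ y := by
        ext x; simp [real_inner_comm]
      rw [this]
      exact (innerSL ℝ y).hasFDerivAt
    have e2 := ((hasStrictFDerivAt_norm_sq x).hasFDerivAt).mul_const (‖y‖ ^ 2)
    refine (((e1.const_mul 2).const_sub 1).add e2).congr_fderiv ?_
    ext v
    simp
    ring
  have h3 : (fun x => greenKernel x y) = fun x => -(1 / (2 * Real.pi)) *
      (Real.log (‖x - y‖ ^ 2) / 2 - Real.log (mirrorDistSq x y) / 2) := by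
    ext x
    rw [greenKernel, Real.log_pow]
    push_cast
    ring
  rw [h3]
  simp only [div_eq_mul_inv _ (2 : ℝ)]
  refine (((h1.mul_const 2⁻¹).sub ((h2.log hm).mul_const 2⁻¹)).const_mul
    (-(1 / (2 * Real.pi)))).congr_fderiv ?_
  ext v
  simp [greenKernelDeriv]
  ring

lemma norm_mirror_gradient_le {x y : Plane} (hx : ‖x‖ ≤ 1) (hy : ‖y‖ ≤ 1 / 2) :
    ‖(mirrorDistSq x y)⁻¹ • (‖y‖ ^ 2 • innerSL ℝ x - innerSL ℝ y)‖ ≤ 3 := by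
  have hm := mirrorDistSq_ge hx hy
  rw [norm_smul, Real.norm_of_nonneg (by positivity)]
  have h1 : (mirrorDistSq x y)⁻¹ ≤ 4 := by
    rw [inv_le_comm₀ (by positivity) (by norm_num)]; linarith
  have h2 : ‖‖y‖ ^ 2 • innerSL ℝ x - innerSL ℝ y‖ ≤ 3 / 4 := by
    refine (norm_sub_le _ _).trans ?_
    rw [norm_smul, innerSL_apply_norm, innerSL_apply_norm, Real.norm_of_nonneg (by positivity)]
    nlinarith [norm_nonneg x, norm_nonneg y]
  calc (mirrorDistSq x y)⁻¹ * ‖‖y‖ ^ 2 • innerSL ℝ x - innerSL ℝ y‖ ≤ 4 * (3 / 4) := by gcongr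
    _ = 3 := by norm_num

lemma norm_greenKernelDeriv_le {x y : Plane} (hx : ‖x‖ ≤ 1) (hy : ‖y‖ ≤ 1 / 2) :
    ‖greenKernelDeriv x y‖ ≤ ‖x - y‖⁻¹ + 3 := by
  have h := norm_mirror_gradient_le hx hy
  have h1 : ‖(‖x - y‖ ^ 2)⁻¹ • innerSL ℝ (x - y)‖ = ‖x - y‖⁻¹ := by
    rw [norm_smul, innerSL_apply_norm, Real.norm_of_nonneg (by positivity)]
    rcases eq_or_ne ‖x - y‖ 0 with h0 | h0
    · simp [h0]
    · field_simp
  rw [greenKernelDeriv, norm_smul, norm_neg, Real.norm_of_nonneg (by positivity)]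
  calc _ ≤ 1 * ‖(‖x - y‖ ^ 2)⁻¹ • innerSL ℝ (x - y) -
        (mirrorDistSq x y)⁻¹ • (‖y‖ ^ 2 • innerSL ℝ x - innerSL ℝ y)‖ := by
        gcongr; exact one_div_two_pi_le_one
    _ ≤ ‖x - y‖⁻¹ + 3 := by
        rw [one_mul, ← h1]
        exact (norm_sub_le _ _).trans (by linarith)

@[fun_prop]
lemma measurable_mirrorDistSq : Measurable fun p : Plane × Plane => mirrorDistSq p.1 p.2 := by
  unfold mirrorDistSq
  fun_prop

lemma measurable_greenKernel : Measurable fun p : Plane × Plane => greenKernel p.1 p.2 := by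
  unfold greenKernel
  have h1 : Measurable fun p : Plane × Plane => Real.log ‖p.1 - p.2‖ :=
    Real.measurable_log.comp (by fun_prop)
  have h2 : Measurable fun p : Plane × Plane => Real.log (mirrorDistSq p.1 p.2) :=
    Real.measurable_log.comp measurable_mirrorDistSq
  exact (h1.sub (h2.div_const 2)).const_mul _

lemma stronglyMeasurable_greenKernelDeriv :
    StronglyMeasurable fun p : Plane × Plane => greenKernelDeriv p.1 p.2 := by
  unfold greenKernelDeriv
  have h1 : Measurable fun p : Plane × Plane => (‖p.1 - p.2‖ ^ 2)⁻¹ := by fun_prop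
  have h2 : Measurable fun p : Plane × Plane => (mirrorDistSq p.1 p.2)⁻¹ :=
    measurable_mirrorDistSq.inv
  have h3 : Continuous fun p : Plane × Plane => innerSL ℝ (p.1 - p.2) := by fun_prop
  have h4 : Continuous fun p : Plane × Plane =>
      ‖p.2‖ ^ 2 • innerSL ℝ p.1 - innerSL ℝ p.2 := by fun_prop
  exact ((h1.stronglyMeasurable.smul h3.stronglyMeasurable).sub
    (h2.stronglyMeasurable.smul h4.stronglyMeasurable)).const_smul (-(1 / (2 * Real.pi)))

/-! ### Green potentials of measures -/

/-- The Green potential of the measure `μ`, with the value `0` where the integral does not exist. -/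
noncomputable def greenPotential (μ : Measure Plane) (x : Plane) : ℝ := ∫ y, greenKernel x y ∂μ

lemma ae_prod_of_norm_le {μ : Measure Plane} [SFinite μ] (hμ : ∀ᵐ y ∂μ, ‖y‖ ≤ 1 / 2) :
    ∀ᵐ p : Plane × Plane ∂((volume.restrict unitDisc).prod μ), ‖p.1‖ ≤ 1 ∧ ‖p.2‖ ≤ 1 / 2 := by
  have h3 : ∀ᵐ p ∂((volume.restrict unitDisc).prod μ), p.1 ∈ unitDisc :=
    Measure.quasiMeasurePreserving_fst.ae (ae_restrict_mem measurableSet_ball)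
  have h4 : ∀ᵐ p ∂((volume.restrict unitDisc).prod μ), ‖p.2‖ ≤ 1 / 2 :=
    Measure.quasiMeasurePreserving_snd.ae hμ
  filter_upwards [h3, h4] with p hp hp' using ⟨(mem_ball_zero_iff.1 hp).le, hp'⟩

section potential
variable {μ : Measure Plane} [IsFiniteMeasure μ]

lemma finrank_plane : Module.finrank ℝ Plane = 2 := by simp

lemma integrable_comp_sub_prod (hμ : ∀ᵐ y ∂μ, ‖y‖ ≤ 1 / 2) {h : Plane → ℝ} (hm : Measurable h)
    (hi : IntegrableOn h (ball 0 2)) :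
    Integrable (fun p : Plane × Plane => h (p.1 - p.2)) ((volume.restrict unitDisc).prod μ) := by
  have hmeas : Measurable fun p : Plane × Plane => h (p.1 - p.2) := hm.comp (by fun_prop)
  set H : Plane → ℝ := (ball 0 2).indicator h
  have hH : Integrable H := (integrable_indicator_iff measurableSet_ball).2 hi
  have hHm : Measurable fun p : Plane × Plane => H (p.1 - p.2) :=
    (hm.indicator measurableSet_ball).comp (by fun_prop)
  have h1 : Integrable (fun p : Plane × Plane => H (p.1 - p.2)) (volume.prod μ) := by
    rw [integrable_prod_iff' hHm.aestronglyMeasurable]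
    refine ⟨Eventually.of_forall fun y => hH.comp_sub_right y, ?_⟩
    have : (fun y => ∫ x, ‖H (x - y)‖) = fun _ => ∫ x, ‖H x‖ := by
      ext y
      exact integral_sub_right_eq_self (fun x => ‖H x‖) y
    rw [this]
    exact integrable_const _
  have h2 : Integrable (fun p : Plane × Plane => H (p.1 - p.2))
      ((volume.restrict unitDisc).prod μ) :=
    h1.mono_measure (Measure.prod_mono Measure.restrict_le_self le_rfl)
  refine h2.congr ?_
  have h3 : ∀ᵐ p ∂((volume.restrict unitDisc).prod μ), p.1 ∈ unitDisc :=
    Measure.quasiMeasurePreserving_fst.ae (ae_restrict_mem measurableSet_ball)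
  filter_upwards [h3, ae_prod_of_norm_le hμ] with p hp hp'
  refine indicator_of_mem ?_ h
  rw [mem_ball_zero_iff] at hp ⊢
  linarith [norm_sub_le p.1 p.2, hp'.2]

instance : IsFiniteMeasure (volume.restrict unitDisc) :=
  isFiniteMeasure_restrict.2 measure_ball_lt_top.ne

lemma integrable_greenKernel (hμ : ∀ᵐ y ∂μ, ‖y‖ ≤ 1 / 2) :
    Integrable (fun p : Plane × Plane => greenKernel p.1 p.2)
      ((volume.restrict unitDisc).prod μ) := by
  refine ((integrable_comp_sub_prod hμ (Real.measurable_log.comp measurable_norm)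
    (integrableOn_log_norm finrank_plane 2)).abs.add (integrable_const 1)).mono'
    measurable_greenKernel.aestronglyMeasurable ?_
  filter_upwards [ae_prod_of_norm_le hμ] with p hp using abs_greenKernel_le hp.1 hp.2

lemma integrable_greenKernel_sq (hμ : ∀ᵐ y ∂μ, ‖y‖ ≤ 1 / 2) :
    Integrable (fun p : Plane × Plane => greenKernel p.1 p.2 ^ 2)
      ((volume.restrict unitDisc).prod μ) := by
  refine (((integrable_comp_sub_prod hμ ((Real.measurable_log.comp measurable_norm).pow_const 2)
    (integrableOn_log_norm_sq finrank_plane 2)).const_mul 2).add (integrable_const 2)).mono'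
    (measurable_greenKernel.pow_const 2).aestronglyMeasurable ?_
  filter_upwards [ae_prod_of_norm_le hμ] with p hp
  have h := abs_greenKernel_le hp.1 hp.2
  have h2 : |greenKernel p.1 p.2| ^ 2 ≤ (|Real.log ‖p.1 - p.2‖| + 1) ^ 2 :=
    pow_le_pow_left₀ (abs_nonneg _) h 2
  rw [norm_pow, Real.norm_eq_abs]
  simp only [Pi.add_apply, Function.comp_apply]
  nlinarith [sq_nonneg (|Real.log ‖p.1 - p.2‖| - 1), sq_abs (Real.log ‖p.1 - p.2‖)]

lemma integrable_greenKernelDeriv (hμ : ∀ᵐ y ∂μ, ‖y‖ ≤ 1 / 2) :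
    Integrable (fun p : Plane × Plane => greenKernelDeriv p.1 p.2)
      ((volume.restrict unitDisc).prod μ) := by
  refine ((integrable_comp_sub_prod hμ measurable_norm.inv
    (integrableOn_inv_norm finrank_plane 2)).add (integrable_const 3)).mono'
    stronglyMeasurable_greenKernelDeriv.aestronglyMeasurable ?_
  filter_upwards [ae_prod_of_norm_le hμ] with p hp using norm_greenKernelDeriv_le hp.1 hp.2

lemma sq_integral_le {α : Type*} [MeasurableSpace α] {μ : Measure α} [IsFiniteMeasure μ]
    {f : α → ℝ} (hf : Integrable f μ) (hf2 : Integrable (fun x => f x ^ 2) μ) :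
    (∫ x, f x ∂μ) ^ 2 ≤ μ.real univ * ∫ x, f x ^ 2 ∂μ := by
  set m := μ.real univ
  set I := ∫ x, f x ∂μ
  have h : 0 ≤ ∫ x, (m ^ 2 * f x ^ 2 - 2 * m * I * f x + I ^ 2) ∂μ :=
    integral_nonneg fun x => by
      have : m ^ 2 * f x ^ 2 - 2 * m * I * f x + I ^ 2 = (m * f x - I) ^ 2 := by ring
      simp only [Pi.zero_apply, this]
      positivity
  rw [integral_add (f := fun x => m ^ 2 * f x ^ 2 - 2 * m * I * f x)
      ((hf2.const_mul _).sub (hf.const_mul _)) (integrable_const _),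
    integral_sub (hf2.const_mul _) (hf.const_mul _), integral_const_mul, integral_const_mul,
    integral_const, smul_eq_mul] at h
  change 0 ≤ m ^ 2 * _ - 2 * m * I * I + m * I ^ 2 at h
  have hm : 0 ≤ m := measureReal_nonneg
  rcases hm.eq_or_lt with h0 | h0
  · have hμ0 : μ = 0 := by
      rw [← Measure.measure_univ_eq_zero]
      exact (measureReal_eq_zero_iff).1 h0.symm
    have : I = 0 := by simp [I, hμ0]
    rw [← h0, this]
    simp
  · have : 0 ≤ m * (m * (∫ x, f x ^ 2 ∂μ) - I ^ 2) := by linarith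
    linarith [nonneg_of_mul_nonneg_right this h0]

lemma memLp_greenPotential (hμ : ∀ᵐ y ∂μ, ‖y‖ ≤ 1 / 2) :
    MemLp (greenPotential μ) 2 (volume.restrict unitDisc) := by
  have hm : AEStronglyMeasurable (greenPotential μ) (volume.restrict unitDisc) :=
    (measurable_greenKernel.stronglyMeasurable.integral_prod_right).aestronglyMeasurable
  rw [memLp_two_iff_integrable_sq hm]
  refine ((integrable_greenKernel_sq hμ).integral_prod_left.const_mul (μ.real univ)).mono'
    (hm.pow 2) ?_
  filter_upwards [(integrable_greenKernel hμ).prod_right_ae,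
    (integrable_greenKernel_sq hμ).prod_right_ae] with x hx hx2
  rw [norm_pow, Real.norm_eq_abs, sq_abs]
  exact sq_integral_le hx hx2

lemma exists_continuousOn_eq_laplacian_plane {φ : Plane → ℝ}
    (hφ : ContDiffOn ℝ 2 φ (closedBall 0 1)) :
    ∃ F : Plane → ℝ, ContinuousOn F (closedBall 0 1) ∧ ∀ x ∈ unitDisc, F x = Δ φ x := by
  have hmaps : ∀ e : ℂ ≃ₗᵢ[ℝ] Plane, MapsTo e.symm (closedBall 0 1) (closedBall 0 1) :=
    fun e x hx => by
      rw [mem_closedBall_zero_iff] at hx ⊢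
      rwa [LinearIsometryEquiv.norm_map]
  obtain ⟨F, hF, hFφ⟩ := exists_continuousOn_eq_laplacian (φ := φ ∘ toPlane)
    (hφ.comp toPlane.contDiff.contDiffOn (fun z hz => by
      rw [mem_closedBall_zero_iff] at hz ⊢
      rwa [LinearIsometryEquiv.norm_map]))
  refine ⟨F ∘ toPlane.symm, hF.comp toPlane.symm.continuous.continuousOn (hmaps toPlane),
    fun x hx => ?_⟩
  rw [Function.comp, hFφ, laplacian_comp_linearIsometryEquiv,
    LinearIsometryEquiv.apply_symm_apply]
  rw [mem_ball_zero_iff] at hx ⊢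
  rwa [LinearIsometryEquiv.norm_map]

lemma isVeryWeakSolution_greenPotential (hμ : ∀ᵐ y ∂μ, ‖y‖ ≤ 1 / 2) :
    IsVeryWeakSolution unitDisc μ (greenPotential μ) where
  memLp := memLp_greenPotential hμ
  integral_eq φ hφ h0 := by
    rw [closure_ball _ one_ne_zero] at hφ
    rw [frontier_ball _ one_ne_zero] at h0
    obtain ⟨F, hF, hFφ⟩ := exists_continuousOn_eq_laplacian_plane hφ
    obtain ⟨C, hC⟩ := (isCompact_closedBall (0 : Plane) 1).exists_bound_of_continuousOn hF
    have hFm : AEStronglyMeasurable F (volume.restrict unitDisc) :=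
      (hF.mono ball_subset_closedBall).aestronglyMeasurable measurableSet_ball
    have hint : Integrable (fun p : Plane × Plane => greenKernel p.1 p.2 * F p.1)
        ((volume.restrict unitDisc).prod μ) := by
      refine (integrable_greenKernel hμ).mul_bdd (c := C) hFm.comp_fst ?_
      filter_upwards [ae_prod_of_norm_le hμ] with p hp
      exact hC _ (mem_closedBall_zero_iff.2 hp.1)
    calc -∫ x in unitDisc, greenPotential μ x * Δ φ x
        = -∫ x in unitDisc, ∫ y, greenKernel x y * F x ∂μ := by
          congr 1
          refine setIntegral_congr_fun measurableSet_ball fun x hx => ?_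
          simp only [greenPotential, integral_mul_const, hFφ x hx]
      _ = -∫ y, (∫ x in unitDisc, greenKernel x y * F x) ∂μ := by
          rw [integral_integral_swap hint]
      _ = ∫ y, φ y ∂μ := by
          rw [← integral_neg]
          refine integral_congr_ae ?_
          filter_upwards [hμ] with y hy
          rw [← integral_greenKernel_mul_laplacian hφ h0 (lt_of_le_of_lt hy (by norm_num))]
          congr 1
          exact setIntegral_congr_fun measurableSet_ball fun x hx => by simp only [hFφ x hx]

lemma integrable_greenKernelDeriv_of_dist {S : Set Plane} (hS : ∀ᵐ y ∂μ, y ∈ S)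
    (hSb : S ⊆ closedBall 0 (1 / 2)) {x : Plane} (hx : ‖x‖ ≤ 1) {δ : ℝ} (hδ : 0 < δ)
    (hd : ∀ y ∈ S, δ ≤ ‖x - y‖) : Integrable (greenKernelDeriv x) μ := by
  refine Integrable.mono' (integrable_const (δ⁻¹ + 3))
    (stronglyMeasurable_greenKernelDeriv.comp_measurable
      (measurable_prodMk_left)).aestronglyMeasurable ?_
  filter_upwards [hS] with y hy
  refine (norm_greenKernelDeriv_le hx (mem_closedBall_zero_iff.1 (hSb hy))).trans ?_
  gcongr
  exact hd y hy

/-- Every point off the support of `μ` has a neighbourhood at positive distance from it. -/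
lemma exists_ball_dist_ge {S : Set Plane} (hSc : IsClosed S) {x : Plane} (hx : x ∈ unitDisc \ S) :
    ∃ δ > 0, ∀ x' ∈ ball x δ, ‖x'‖ ≤ 1 ∧ ∀ y ∈ S, δ ≤ ‖x' - y‖ := by
  obtain ⟨r, hr, hrs⟩ := Metric.isOpen_iff.1 (isOpen_ball.sdiff hSc) x hx
  refine ⟨r / 2, half_pos hr, fun x' hx' => ⟨?_, fun y hy => ?_⟩⟩
  · exact (mem_ball_zero_iff.1 (hrs (ball_subset_ball (half_le_self hr.le) hx')).1).le
  · by_contra! h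
    refine (hrs (show y ∈ ball x r from ?_)).2 hy
    rw [mem_ball] at hx' ⊢
    have := dist_triangle y x' x
    rw [dist_comm y x', dist_eq_norm x' y] at this
    linarith

lemma hasFDerivAt_greenPotential {S : Set Plane} (hS : ∀ᵐ y ∂μ, y ∈ S) (hSc : IsClosed S)
    (hSb : S ⊆ closedBall 0 (1 / 2)) {x : Plane} (hx : x ∈ unitDisc \ S) :
    HasFDerivAt (greenPotential μ) (∫ y, greenKernelDeriv x y ∂μ) x := by
  obtain ⟨δ, hδ, hδx⟩ := exists_ball_dist_ge hSc hx
  have hmeas : ∀ x, AEStronglyMeasurable (greenKernel x) μ := fun x =>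
    (measurable_greenKernel.comp measurable_prodMk_left).aestronglyMeasurable
  refine hasFDerivAt_integral_of_dominated_of_fderiv_le (bound := fun _ => δ⁻¹ + 3)
    (ball_mem_nhds x hδ) (Eventually.of_forall hmeas) ?_
    (stronglyMeasurable_greenKernelDeriv.comp_measurable
      (measurable_prodMk_left)).aestronglyMeasurable ?_ (integrable_const _) ?_
  · refine Integrable.mono' (integrable_const (6 * δ ^ (-(1 / 2) : ℝ) + 1)) (hmeas x) ?_
    filter_upwards [hS] with y hy
    have hx1 := (hδx x (mem_ball_self hδ)).1
    have hy1 := mem_closedBall_zero_iff.1 (hSb hy)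
    refine (abs_greenKernel_le hx1 hy1).trans ?_
    have h1 := abs_log_le_rpow (norm_nonneg (x - y)) (r := 2) (by
      linarith [norm_sub_le x y])
    have h2 : ‖x - y‖ ^ (-(1 / 2) : ℝ) ≤ δ ^ (-(1 / 2) : ℝ) :=
      Real.rpow_le_rpow_of_nonpos hδ ((hδx x (mem_ball_self hδ)).2 y hy) (by norm_num)
    linarith
  · filter_upwards [hS] with y hy x' hx'
    refine (norm_greenKernelDeriv_le (hδx x' hx').1 (mem_closedBall_zero_iff.1 (hSb hy))).trans ?_
    gcongr
    exact (hδx x' hx').2 y hy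
  · filter_upwards [hS] with y hy x' hx'
    refine hasFDerivAt_greenKernel (fun h => ?_) (ne_of_gt (lt_of_lt_of_le (by norm_num)
      (mirrorDistSq_ge (hδx x' hx').1 (mem_closedBall_zero_iff.1 (hSb hy)))))
    have := (hδx x' hx').2 y hy
    rw [h, sub_self, norm_zero] at this
    linarith

lemma contDiffOn_greenPotential {S : Set Plane} (hS : ∀ᵐ y ∂μ, y ∈ S) (hSc : IsClosed S)
    (hSb : S ⊆ closedBall 0 (1 / 2)) : ContDiffOn ℝ 1 (greenPotential μ) (unitDisc \ S) := by
  have hopen : IsOpen (unitDisc \ S) := isOpen_ball.sdiff hSc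
  rw [← zero_add (1 : WithTop ℕ∞), contDiffOn_succ_iff_fderiv_of_isOpen hopen]
  refine ⟨fun x hx =>
    (hasFDerivAt_greenPotential hS hSc hSb hx).differentiableAt.differentiableWithinAt,
    by simp, ?_⟩
  rw [contDiffOn_zero]
  have : ContinuousOn (fun x => ∫ y, greenKernelDeriv x y ∂μ) (unitDisc \ S) := by
    intro x hx
    obtain ⟨δ, hδ, hδx⟩ := exists_ball_dist_ge hSc hx
    refine ContinuousAt.continuousWithinAt ?_
    refine continuousAt_of_dominated (bound := fun _ => δ⁻¹ + 3)
      (Eventually.of_forall fun x => (stronglyMeasurable_greenKernelDeriv.comp_measurable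
        (measurable_prodMk_left)).aestronglyMeasurable) ?_ (integrable_const _) ?_
    · filter_upwards [ball_mem_nhds x hδ] with x' hx'
      filter_upwards [hS] with y hy
      refine (norm_greenKernelDeriv_le (hδx x' hx').1
        (mem_closedBall_zero_iff.1 (hSb hy))).trans ?_
      gcongr
      exact (hδx x' hx').2 y hy
    · filter_upwards [hS] with y hy
      have hx1 := (hδx x (mem_ball_self hδ)).1
      have h1 : mirrorDistSq x y ≠ 0 := (ne_of_gt (lt_of_lt_of_le (by norm_num)
        (mirrorDistSq_ge hx1 (mem_closedBall_zero_iff.1 (hSb hy)))))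
      have h2 : ‖x - y‖ ^ 2 ≠ 0 := by
        exact pow_ne_zero 2 (hδ.trans_le ((hδx x (mem_ball_self hδ)).2 y hy)).ne'
      have h3 : ContinuousAt (fun x => mirrorDistSq x y) x := by
        unfold mirrorDistSq
        fun_prop
      unfold greenKernelDeriv
      have h4 : ContinuousAt (fun x : Plane => (‖x - y‖ ^ 2)⁻¹) x :=
        ContinuousAt.inv₀ (by fun_prop) h2
      have h5 : ContinuousAt (fun x => (mirrorDistSq x y)⁻¹) x := h3.inv₀ h1
      fun_prop
  exact this.congr fun x hx => (hasFDerivAt_greenPotential hS hSc hSb hx).fderiv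

end potential

/-! ### The weak derivative of a Green potential -/

lemma toPlane_apply (z : ℂ) : toPlane z = pt z.re z.im := by
  ext i
  fin_cases i <;> simp [toPlane]

lemma pt_eq_add_smul (t s : ℝ) : pt t s = pt 0 s + t • basisVec 0 := by
  ext i
  fin_cases i <;> simp

lemma isometry_pt_left (s : ℝ) : Isometry fun t : ℝ => pt t s := by
  refine Isometry.of_dist_eq fun t t' => ?_
  rw [EuclideanSpace.dist_eq]
  simp [Fin.sum_univ_two, Real.sqrt_sq_eq_abs, Real.dist_eq]

lemma hasDerivAt_pt_left (t s : ℝ) : HasDerivAt (fun t : ℝ => pt t s) (basisVec 0) t := by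
  have h : (fun t : ℝ => pt t s) = fun t => pt 0 s + t • basisVec 0 :=
    funext fun t => pt_eq_add_smul t s
  rw [h]
  simpa using ((hasDerivAt_id t).smul_const (basisVec 0)).const_add (pt 0 s)

/-- The integral of the first partial derivative of a compactly supported function vanishes, even
if the function is singular on one horizontal line: integrate along the other lines. -/
lemma integral_eq_zero_of_hasDerivAt_pt_left {F F' : Plane → ℝ} {c : ℝ}
    (hF : ∀ t s : ℝ, s ≠ c → HasDerivAt (fun t => F (pt t s)) (F' (pt t s)) t)
    (hc : HasCompactSupport F) (hF' : Integrable F') : ∫ x, F' x = 0 := by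
  have hmp : MeasurePreserving (fun p : ℝ × ℝ => pt p.1 p.2) volume volume := by
    have h := toPlane.measurePreserving.comp
      (Complex.volume_preserving_equiv_real_prod.symm Complex.measurableEquivRealProd)
    have e : toPlane ∘ Complex.measurableEquivRealProd.symm = fun p : ℝ × ℝ => pt p.1 p.2 := by
      ext1 p
      rw [Function.comp, toPlane_apply]
      rfl
    rwa [e] at h
  have hemb : MeasurableEmbedding fun p : ℝ × ℝ => pt p.1 p.2 := by
    have e : (fun p : ℝ × ℝ => pt p.1 p.2) = toPlane ∘ Complex.measurableEquivRealProd.symm := by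
      ext1 p
      rw [Function.comp, toPlane_apply]
      rfl
    rw [e]
    exact toPlane.toHomeomorph.measurableEmbedding.comp
      Complex.measurableEquivRealProd.symm.measurableEmbedding
  have hi : Integrable (fun p : ℝ × ℝ => F' (pt p.1 p.2)) (volume.prod volume) := by
    rw [← Measure.volume_eq_prod]
    exact (hmp.integrable_comp_emb hemb).2 hF'
  rw [← hmp.integral_comp hemb, Measure.volume_eq_prod, integral_prod_symm _ hi]
  refine integral_eq_zero_of_ae ?_
  filter_upwards [hi.prod_left_ae, Measure.ae_ne volume c] with s hs hsc
  refine integral_eq_zero_of_hasDerivAt_of_integrable (fun t => hF t s hsc) hs ?_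
  exact (continuous_iff_continuousAt.2 fun t => (hF t s hsc).continuousAt)
    |>.integrable_of_hasCompactSupport (hc.comp_isClosedEmbedding
      (isometry_pt_left s).isClosedEmbedding)

lemma abs_apply_basisVec_le (L : Plane →L[ℝ] ℝ) (i : Fin 2) : |L (basisVec i)| ≤ ‖L‖ := by
  have h := L.le_opNorm (basisVec i)
  rwa [PiLp.norm_single, norm_one, mul_one, Real.norm_eq_abs] at h

section potential
variable {μ : Measure Plane} [IsFiniteMeasure μ]

lemma integral_greenKernel_mul_fderiv {φ : Plane → ℝ} (hφ : ContDiff ℝ ∞ φ)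
    (hc : HasCompactSupport φ) (hs : tsupport φ ⊆ unitDisc) {y : Plane} (hy : ‖y‖ ≤ 1 / 2)
    (hG : IntegrableOn (fun x => greenKernel x y) unitDisc)
    (hG' : IntegrableOn (fun x => greenKernelDeriv x y (basisVec 0)) unitDisc) :
    ∫ x in unitDisc, greenKernel x y * fderiv ℝ φ x (basisVec 0) =
      -∫ x in unitDisc, greenKernelDeriv x y (basisVec 0) * φ x := by
  have hφ1 : Continuous fun x => fderiv ℝ φ x (basisVec 0) :=
    (hφ.continuous_fderiv (by simp)).clm_apply continuous_const
  have hcd : HasCompactSupport fun x => fderiv ℝ φ x (basisVec 0) :=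
    hc.fderiv_apply ℝ _
  have hzero : ∀ x ∉ unitDisc, φ =ᶠ[𝓝 x] 0 := fun x hx =>
    notMem_tsupport_iff_eventuallyEq.1 fun h => hx (hs h)
  obtain ⟨C, hC⟩ := hc.exists_bound_of_continuous hφ.continuous
  obtain ⟨C', hC'⟩ := hcd.exists_bound_of_continuous hφ1
  have h1 : IntegrableOn (fun x => greenKernel x y * fderiv ℝ φ x (basisVec 0)) unitDisc :=
    Integrable.mul_bdd (c := C') hG hφ1.aestronglyMeasurable (Eventually.of_forall hC')
  have h2 : IntegrableOn (fun x => greenKernelDeriv x y (basisVec 0) * φ x) unitDisc :=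
    Integrable.mul_bdd (c := C) hG' hφ.continuous.aestronglyMeasurable (Eventually.of_forall hC)
  have hF'0 : ∀ x ∉ unitDisc, greenKernel x y * fderiv ℝ φ x (basisVec 0) +
      greenKernelDeriv x y (basisVec 0) * φ x = 0 := fun x hx => by
    rw [(hzero x hx).fderiv_eq, (hzero x hx).eq_of_nhds]
    simp
  have key : ∫ x, (greenKernel x y * fderiv ℝ φ x (basisVec 0) +
      greenKernelDeriv x y (basisVec 0) * φ x) = 0 := by
    refine integral_eq_zero_of_hasDerivAt_pt_left (F := fun x => greenKernel x y * φ x) (c := y 1)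
      (fun t s hts => ?_) (hc.mul_left) ?_
    · by_cases hx : pt t s ∈ unitDisc
      · have hne : pt t s ≠ y := fun h => hts (by rw [← h]; simp)
        have hm : mirrorDistSq (pt t s) y ≠ 0 := (ne_of_gt (lt_of_lt_of_le (by norm_num)
          (mirrorDistSq_ge (mem_ball_zero_iff.1 hx).le hy)))
        have hd := (hasFDerivAt_greenKernel hne hm).mul
          ((hφ.differentiable (by simp)).differentiableAt (x := pt t s)).hasFDerivAt
        refine (hd.comp_hasDerivAt t (hasDerivAt_pt_left t s)).congr_deriv ?_
        simp [mul_comm]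
      · rw [hF'0 _ hx]
        refine HasDerivAt.congr_of_eventuallyEq (hasDerivAt_const t (0 : ℝ)) ?_
        filter_upwards [(hasDerivAt_pt_left t s).continuousAt.eventually (hzero _ hx)] with t' ht'
        simp [ht']
    · rw [← integrableOn_iff_integrable_of_support_subset (s := unitDisc)]
      · exact h1.add h2
      · intro x hx
        by_contra h
        exact hx (hF'0 x h)
  rw [← setIntegral_eq_integral_of_forall_compl_eq_zero hF'0, integral_add h1 h2] at key
  linarith

lemma hasWeakPartialDeriv_greenPotential (hμ : ∀ᵐ y ∂μ, ‖y‖ ≤ 1 / 2) :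
    HasWeakPartialDeriv unitDisc 0 (greenPotential μ)
      (fun x => ∫ y, greenKernelDeriv x y (basisVec 0) ∂μ) := by
  have hG := integrable_greenKernel hμ
  have hG' : Integrable (fun p : Plane × Plane => greenKernelDeriv p.1 p.2 (basisVec 0))
      ((volume.restrict unitDisc).prod μ) :=
    (integrable_greenKernelDeriv hμ).apply_continuousLinearMap _
  refine ⟨IntegrableOn.locallyIntegrableOn hG.integral_prod_left,
    IntegrableOn.locallyIntegrableOn hG'.integral_prod_left, fun φ hφ hc hs => ?_⟩
  have hφ1 : Continuous fun x => fderiv ℝ φ x (basisVec 0) :=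
    (hφ.continuous_fderiv (by simp)).clm_apply continuous_const
  obtain ⟨C, hC⟩ := hc.exists_bound_of_continuous hφ.continuous
  obtain ⟨C', hC'⟩ := (hc.fderiv_apply ℝ (basisVec 0)).exists_bound_of_continuous hφ1
  have h1 : Integrable (fun p : Plane × Plane => greenKernel p.1 p.2 *
      fderiv ℝ φ p.1 (basisVec 0)) ((volume.restrict unitDisc).prod μ) :=
    hG.mul_bdd (c := C') (hφ1.comp continuous_fst).aestronglyMeasurable
      (Eventually.of_forall fun p => hC' p.1)
  have h2 : Integrable (fun p : Plane × Plane => greenKernelDeriv p.1 p.2 (basisVec 0) *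
      φ p.1) ((volume.restrict unitDisc).prod μ) :=
    hG'.mul_bdd (c := C) (hφ.continuous.comp continuous_fst).aestronglyMeasurable
      (Eventually.of_forall fun p => hC p.1)
  simp only [greenPotential, ← integral_mul_const]
  rw [integral_integral_swap (f := fun x y => greenKernel x y * fderiv ℝ φ x (basisVec 0)) h1,
    integral_integral_swap (f := fun x y => greenKernelDeriv x y (basisVec 0) * φ x) h2,
    ← integral_neg]
  refine integral_congr_ae ?_
  filter_upwards [hμ, hG.prod_left_ae, hG'.prod_left_ae] with y hy hy1 hy2
  exact integral_greenKernel_mul_fderiv hφ hc hs hy hy1 hy2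

end potential

/-! ### Calculus of weak derivatives -/

lemma setIntegral_eq_of_tsupport_subset {Ω Ω' : Set Plane} (h : Ω' ⊆ Ω) {f φ : Plane → ℝ}
    (hφ : tsupport φ ⊆ Ω') (hf : ∀ x ∉ tsupport φ, f x = 0) :
    ∫ x in Ω', f x = ∫ x in Ω, f x := by
  rw [setIntegral_eq_integral_of_forall_compl_eq_zero fun x hx => hf x fun h' => hx (hφ h'),
    setIntegral_eq_integral_of_forall_compl_eq_zero fun x hx => hf x fun h' => hx (h (hφ h'))]

lemma HasWeakPartialDeriv.mono {Ω Ω' : Set Plane} {i : Fin 2} {u g : Plane → ℝ}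
    (h : HasWeakPartialDeriv Ω i u g) (hΩ : Ω' ⊆ Ω) : HasWeakPartialDeriv Ω' i u g where
  locallyIntegrableOn := h.locallyIntegrableOn.mono_set hΩ
  locallyIntegrableOn_deriv := h.locallyIntegrableOn_deriv.mono_set hΩ
  integral_eq φ hφ hc hs := by
    rw [setIntegral_eq_of_tsupport_subset hΩ hs, setIntegral_eq_of_tsupport_subset hΩ hs]
    · exact h.integral_eq φ hφ hc (hs.trans hΩ)
    · intro x hx
      rw [image_eq_zero_of_notMem_tsupport hx, mul_zero]
    · intro x hx
      rw [(notMem_tsupport_iff_eventuallyEq.1 hx).fderiv_eq]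
      simp

lemma HasWeakPartialDeriv.congr {Ω : Set Plane} {i : Fin 2}
    {u v g k : Plane → ℝ} (h : HasWeakPartialDeriv Ω i u g) (huv : u =ᵐ[volume.restrict Ω] v)
    (hgk : g =ᵐ[volume.restrict Ω] k) : HasWeakPartialDeriv Ω i v k where
  locallyIntegrableOn := fun x hx => by
    obtain ⟨t, ht, hu⟩ := h.locallyIntegrableOn x hx
    exact ⟨t ∩ Ω, inter_mem ht self_mem_nhdsWithin, (hu.mono_set inter_subset_left).congr_fun_ae
      (ae_restrict_of_ae_restrict_of_subset inter_subset_right huv)⟩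
  locallyIntegrableOn_deriv := fun x hx => by
    obtain ⟨t, ht, hu⟩ := h.locallyIntegrableOn_deriv x hx
    exact ⟨t ∩ Ω, inter_mem ht self_mem_nhdsWithin, (hu.mono_set inter_subset_left).congr_fun_ae
      (ae_restrict_of_ae_restrict_of_subset inter_subset_right hgk)⟩
  integral_eq φ hφ hc hs := by
    have e1 : ∫ x in Ω, v x * fderiv ℝ φ x (basisVec i) =
        ∫ x in Ω, u x * fderiv ℝ φ x (basisVec i) :=
      integral_congr_ae (by filter_upwards [huv] with x hx; rw [hx])
    have e2 : ∫ x in Ω, k x * φ x = ∫ x in Ω, g x * φ x :=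
      integral_congr_ae (by filter_upwards [hgk] with x hx; rw [hx])
    rw [e1, e2]
    exact h.integral_eq φ hφ hc hs

lemma HasWeakPartialDeriv.ae_eq {Ω : Set Plane} (hΩ : IsOpen Ω) {i : Fin 2} {u g k : Plane → ℝ}
    (hg : HasWeakPartialDeriv Ω i u g) (hk : HasWeakPartialDeriv Ω i u k) :
    g =ᵐ[volume.restrict Ω] k := by
  have h := hΩ.ae_eq_zero_of_integral_contDiff_smul_eq_zero (μ := volume) (f := fun x => g x - k x)
    (hg.locallyIntegrableOn_deriv.sub hk.locallyIntegrableOn_deriv) fun φ hφ hc hs => ?_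
  · rw [EventuallyEq, ae_restrict_iff' hΩ.measurableSet]
    filter_upwards [h] with x hx hxΩ using sub_eq_zero.1 (hx hxΩ)
  · have hint : ∀ {f : Plane → ℝ}, LocallyIntegrableOn f Ω →
        IntegrableOn (fun x => f x * φ x) Ω := by
      intro f hf
      have h1 : IntegrableOn f (tsupport φ) := hf.integrableOn_compact_subset hs hc
      obtain ⟨C, hC⟩ := hc.exists_bound_of_continuous hφ.continuous
      have h2 : IntegrableOn (fun x => f x * φ x) (tsupport φ) :=
        Integrable.mul_bdd (c := C) h1 hφ.continuous.aestronglyMeasurable (Eventually.of_forall hC)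
      refine Integrable.integrableOn ?_
      rw [← integrableOn_iff_integrable_of_support_subset (s := tsupport φ)]
      · exact h2
      · intro x hx
        by_contra h'
        exact hx (by simp [image_eq_zero_of_notMem_tsupport h'])
    have e : ∫ x, φ x • (g x - k x) = ∫ x in Ω, (g x * φ x - k x * φ x) := by
      rw [← setIntegral_eq_integral_of_forall_compl_eq_zero (s := Ω) fun x hx => by
        rw [image_eq_zero_of_notMem_tsupport (fun hx' => hx (hs hx')), zero_smul]]
      refine integral_congr_ae (Eventually.of_forall fun x => ?_)
      simp only [smul_eq_mul]
      ring
    rw [e, integral_sub (hint hg.locallyIntegrableOn_deriv) (hint hk.locallyIntegrableOn_deriv)]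
    have := hg.integral_eq φ hφ hc hs
    have := hk.integral_eq φ hφ hc hs
    linarith

/-! ### The triangle -/

lemma continuous_coord (i : Fin 2) : Continuous fun x : Plane => x i := by fun_prop

lemma isOpen_triangle : IsOpen triangle := by
  have h0 := continuous_coord 0
  have h1 := continuous_coord 1
  exact (isOpen_lt continuous_const h0).inter
    ((isOpen_lt continuous_const h1).inter (isOpen_lt (h0.add h1) continuous_const))

lemma convex_triangle : Convex ℝ triangle := by
  have h0 := (convex_Ioi (0 : ℝ)).linear_preimage
    (EuclideanSpace.proj 0 : Plane →L[ℝ] ℝ).toLinearMap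
  have h1 := (convex_Ioi (0 : ℝ)).linear_preimage
    (EuclideanSpace.proj 1 : Plane →L[ℝ] ℝ).toLinearMap
  have h2 := (convex_Iio (1 / 2 : ℝ)).linear_preimage
    (EuclideanSpace.proj 0 + EuclideanSpace.proj 1 : Plane →L[ℝ] ℝ).toLinearMap
  exact h0.inter (h1.inter h2)

lemma mem_closure_triangle {x : Plane} :
    x ∈ closure triangle ↔ 0 ≤ x 0 ∧ 0 ≤ x 1 ∧ x 0 + x 1 ≤ 1 / 2 := by
  have h0 := continuous_coord 0
  have h1 := continuous_coord 1
  constructor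
  · have hc : IsClosed {x : Plane | 0 ≤ x 0 ∧ 0 ≤ x 1 ∧ x 0 + x 1 ≤ 1 / 2} :=
      (isClosed_le continuous_const h0).inter
        ((isClosed_le continuous_const h1).inter (isClosed_le (h0.add h1) continuous_const))
    have hsub : triangle ⊆ {x : Plane | 0 ≤ x 0 ∧ 0 ≤ x 1 ∧ x 0 + x 1 ≤ 1 / 2} :=
      fun x hx => ⟨hx.1.le, hx.2.1.le, hx.2.2.le⟩
    exact fun hx => closure_minimal hsub hc hx
  · rintro ⟨hx0, hx1, hx2⟩
    have ht : Tendsto (fun t : ℝ => x + t • (pt (1 / 8) (1 / 8) - x)) (𝓝[>] 0) (𝓝 x) := by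
      have hcont : Continuous fun t : ℝ => x + t • (pt (1 / 8) (1 / 8) - x) := by fun_prop
      have := hcont.tendsto 0
      rw [zero_smul, add_zero] at this
      exact this.mono_left nhdsWithin_le_nhds
    refine mem_closure_of_tendsto ht ?_
    filter_upwards [Ioo_mem_nhdsGT (zero_lt_one (α := ℝ))] with t ht
    obtain ⟨ht0, ht1⟩ := ht
    simp only [triangle, mem_ofPred_eq, PiLp.add_apply, PiLp.smul_apply, PiLp.sub_apply,
      smul_eq_mul]
    simp
    refine ⟨?_, ?_, ?_⟩ <;> nlinarith

lemma mem_frontier_triangle {x : Plane} :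
    x ∈ frontier triangle ↔ (0 ≤ x 0 ∧ 0 ≤ x 1 ∧ x 0 + x 1 ≤ 1 / 2) ∧
      (x 0 = 0 ∨ x 1 = 0 ∨ x 0 + x 1 = 1 / 2) := by
  rw [isOpen_triangle.frontier_eq, Set.mem_sdiff, mem_closure_triangle]
  refine and_congr_right fun ⟨h0, h1, h2⟩ => ?_
  simp only [triangle, mem_ofPred_eq, not_and_or, not_lt]
  constructor
  · rintro (h | h | h)
    · exact Or.inl (le_antisymm h h0)
    · exact Or.inr (Or.inl (le_antisymm h h1))
    · exact Or.inr (Or.inr (le_antisymm h2 h))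
  · rintro (h | h | h)
    · exact Or.inl h.le
    · exact Or.inr (Or.inl h.le)
    · exact Or.inr (Or.inr h.ge)

lemma mem_segment_pt {a b c d : ℝ} {x : Plane} : x ∈ segment ℝ (pt a b) (pt c d) ↔
    ∃ t ∈ Icc (0 : ℝ) 1, x 0 = a + t * (c - a) ∧ x 1 = b + t * (d - b) := by
  rw [segment_eq_image']
  constructor
  · rintro ⟨t, ht, rfl⟩
    exact ⟨t, ht, by simp, by simp⟩
  · rintro ⟨t, ht, h0, h1⟩
    refine ⟨t, ht, ?_⟩
    ext i
    fin_cases i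
    · simp [h0]
    · simp [h1]

lemma frontier_triangle : frontier triangle = triangleSides := by
  ext x
  rw [mem_frontier_triangle, triangleSides, mem_union, mem_union, mem_segment_pt, mem_segment_pt,
    mem_segment_pt]
  constructor
  · rintro ⟨⟨h0, h1, h2⟩, h | h | h⟩
    · exact Or.inl (Or.inr ⟨2 * x 1, ⟨by linarith, by linarith⟩, by linarith, by linarith⟩)
    · exact Or.inl (Or.inl ⟨2 * x 0, ⟨by linarith, by linarith⟩, by linarith, by linarith⟩)
    · exact Or.inr ⟨2 * x 1, ⟨by linarith, by linarith⟩, by linarith, by linarith⟩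
  · rintro ((⟨t, ⟨ht0, ht1⟩, h0, h1⟩ | ⟨t, ⟨ht0, ht1⟩, h0, h1⟩) | ⟨t, ⟨ht0, ht1⟩, h0, h1⟩)
    · exact ⟨⟨by linarith, by linarith, by linarith⟩, Or.inr (Or.inl (by linarith))⟩
    · exact ⟨⟨by linarith, by linarith, by linarith⟩, Or.inl (by linarith)⟩
    · exact ⟨⟨by linarith, by linarith, by linarith⟩, Or.inr (Or.inr (by linarith))⟩

lemma closure_triangle_subset : closure triangle ⊆ closedBall 0 (1 / 2) := by
  intro x hx
  obtain ⟨h0, h1, h2⟩ := mem_closure_triangle.1 hx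
  rw [mem_closedBall_zero_iff, EuclideanSpace.norm_eq, Fin.sum_univ_two]
  refine Real.sqrt_le_iff.2 ⟨by norm_num, ?_⟩
  rw [Real.norm_of_nonneg h0, Real.norm_of_nonneg h1]
  nlinarith

lemma triangleSides_subset : triangleSides ⊆ closedBall 0 (1 / 2) := by
  rw [← frontier_triangle]
  exact frontier_subset_closure.trans closure_triangle_subset

lemma isClosed_triangleSides : IsClosed triangleSides := by
  rw [← frontier_triangle]
  exact isClosed_frontier

lemma volume_triangleSides : volume triangleSides = 0 := by
  rw [← frontier_triangle]
  exact convex_triangle.addHaar_frontier volume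

lemma isConnected_triangleSides : IsConnected triangleSides := by
  have hs : ∀ p q : Plane, IsConnected (segment ℝ p q) := fun p q =>
    ⟨⟨p, left_mem_segment ℝ p q⟩, (convex_segment p q).isPreconnected⟩
  refine IsConnected.union ⟨pt (1 / 2) 0, Or.inl (right_mem_segment ℝ _ _),
    left_mem_segment ℝ _ _⟩ (IsConnected.union ⟨pt 0 0, left_mem_segment ℝ _ _,
    left_mem_segment ℝ _ _⟩ (hs _ _) (hs _ _)) (hs _ _)

/-! ### Lipschitz charts -/

/-- The rotation with matrix `(a, -b; b, a)`. -/
noncomputable def planeRotation (a b : ℝ) (h : a ^ 2 + b ^ 2 = 1) : Plane ≃ₗᵢ[ℝ] Plane where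
  toFun z := pt (a * z 0 - b * z 1) (b * z 0 + a * z 1)
  invFun x := pt (a * x 0 + b * x 1) (a * x 1 - b * x 0)
  map_add' z w := by ext i; fin_cases i <;> simp <;> ring
  map_smul' c z := by ext i; fin_cases i <;> simp <;> ring
  left_inv z := by
    ext i
    fin_cases i
    · simp only [Fin.zero_eta, Matrix.cons_val_zero, Matrix.cons_val_one]
      linear_combination z 0 * h
    · simp only [Fin.mk_one, Matrix.cons_val_zero, Matrix.cons_val_one]
      linear_combination z 1 * h
  right_inv z := by
    ext i
    fin_cases i
    · simp only [Fin.zero_eta, Matrix.cons_val_zero, Matrix.cons_val_one]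
      linear_combination z 0 * h
    · simp only [Fin.mk_one, Matrix.cons_val_zero, Matrix.cons_val_one]
      linear_combination z 1 * h
  norm_map' z := by
    rw [EuclideanSpace.norm_eq, EuclideanSpace.norm_eq, Fin.sum_univ_two, Fin.sum_univ_two]
    congr 1
    simp only [Real.norm_eq_abs, sq_abs]
    simp
    linear_combination (z 0 ^ 2 + z 1 ^ 2) * h

lemma planeRotation_apply (a b : ℝ) (h : a ^ 2 + b ^ 2 = 1) (z : Plane) :
    planeRotation a b h z = pt (a * z 0 - b * z 1) (b * z 0 + a * z 1) := rfl

/-- A local description of `D` as a strict subgraph of a globally Lipschitz function yields a chart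
as in the definition of a Lipschitz boundary: the cylinder has to be much thinner than high. -/
lemma exists_lipschitz_chart {D : Set Plane} {p : Plane} (hp : p ∈ frontier D)
    (O : Plane ≃ₗᵢ[ℝ] Plane) {K : ℝ≥0} {f : ℝ → ℝ} (hf : LipschitzWith K f)
    (hD : ∀ᶠ z in 𝓝 (O.symm p), (O z ∈ D ↔ z 1 < f (z 0)) ∧ (O z ∈ frontier D ↔ z 1 = f (z 0))) :
    ∃ (O : Plane ≃ₗᵢ[ℝ] Plane) (a r c d : ℝ) (K : ℝ≥0) (f : ℝ → ℝ),
    LipschitzOnWith K f (closedBall a (4 * r)) ∧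
    MapsTo f (closedBall a (4 * r)) (Ioo c d) ∧
    p ∈ O '' cylinder a r c d ∧
    frontier D ∩ O '' cylinder a r c d = O '' {z ∈ cylinder a r c d | z 1 = f (z 0)} ∧
    D ∩ O '' cylinder a r c d = O '' {z ∈ cylinder a r c d | z 1 < f (z 0)} := by
  set q := O.symm p
  have hq : q 1 = f (q 0) := hD.self_of_nhds.2.1 (by simpa [q] using hp)
  obtain ⟨ρ, hρ, hball⟩ := Metric.eventually_nhds_iff.1 hD
  have hK : (0 : ℝ) < K + 1 := by positivity
  set r : ℝ := ρ / (16 * (K + 1)) with hr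
  have hr0 : 0 < r := by positivity
  have hr1 : 16 * (K * r) + 16 * r = ρ := by
    rw [hr]; field_simp
  have hKr : 0 ≤ K * r := by positivity
  have hcyl : ∀ z ∈ cylinder (q 0) r (q 1 - ρ / 2) (q 1 + ρ / 2),
      (O z ∈ D ↔ z 1 < f (z 0)) ∧ (O z ∈ frontier D ↔ z 1 = f (z 0)) := by
    rintro z ⟨hz0, hz1, hz1'⟩
    apply hball
    rw [EuclideanSpace.dist_eq, Fin.sum_univ_two, Real.sqrt_lt' hρ]
    rw [mem_ball] at hz0
    have h1 : dist (z 1) (q 1) ≤ ρ / 2 := by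
      rw [Real.dist_eq, abs_le]; constructor <;> linarith
    have h0 : dist (z 0) (q 0) ≤ ρ / 2 := by linarith
    have h0' := dist_nonneg (x := z 0) (y := q 0)
    have h1' := dist_nonneg (x := z 1) (y := q 1)
    nlinarith
  refine ⟨O, q 0, r, q 1 - ρ / 2, q 1 + ρ / 2, K, f, hf.lipschitzOnWith, fun s hs => ?_,
    ⟨q, ⟨mem_ball_self hr0, by constructor <;> linarith⟩, by simp [q]⟩, ?_, ?_⟩
  · have h := hf.dist_le_mul s (q 0)
    rw [← hq, Real.dist_eq] at h
    have h2 : (K : ℝ) * dist s (q 0) ≤ K * (4 * r) := by gcongr; exact hs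
    have h3 := abs_le.1 (h.trans h2)
    constructor <;> linarith
  · ext x
    constructor
    · rintro ⟨hx, z, hz, rfl⟩
      exact ⟨z, ⟨hz, (hcyl z hz).2.1 hx⟩, rfl⟩
    · rintro ⟨z, ⟨hz, hzf⟩, rfl⟩
      exact ⟨(hcyl z hz).2.2 hzf, z, hz, rfl⟩
  · ext x
    constructor
    · rintro ⟨hx, z, hz, rfl⟩
      exact ⟨z, ⟨hz, (hcyl z hz).1.1 hx⟩, rfl⟩
    · rintro ⟨z, ⟨hz, hzf⟩, rfl⟩
      exact ⟨(hcyl z hz).1.2 hzf, z, hz, rfl⟩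

lemma exists_lipschitzWith_min_affine (m n c d : ℝ) :
    ∃ K, LipschitzWith K fun s : ℝ => min (m * s + c) (n * s + d) := by
  have h : ∀ m c : ℝ, LipschitzWith ‖m‖₊ fun s : ℝ => m * s + c := fun m c =>
    LipschitzWith.of_dist_le_mul fun s t => by
      rw [Real.dist_eq, Real.dist_eq, coe_nnnorm, Real.norm_eq_abs, ← abs_mul]
      exact le_of_eq (by congr 1; ring)
  exact ⟨_, (h m c).min (h n d)⟩

lemma lt_min_iff_and_eq_min_iff {u v t c₁ c₂ L₁ L₂ L₃ : ℝ} (hc₁ : 0 < c₁) (hc₂ : 0 < c₂)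
    (h₁ : L₁ = c₁ * (u - t)) (h₂ : L₂ = c₂ * (v - t)) (h₃ : 0 < L₃) :
    ((0 < L₁ ∧ 0 < L₂ ∧ 0 < L₃) ↔ t < min u v) ∧
      (((0 ≤ L₁ ∧ 0 ≤ L₂ ∧ 0 ≤ L₃) ∧ (L₁ = 0 ∨ L₂ = 0 ∨ L₃ = 0)) ↔ t = min u v) := by
  subst h₁ h₂
  simp only [mul_pos_iff_of_pos_left hc₁, mul_pos_iff_of_pos_left hc₂,
    mul_nonneg_iff_of_pos_left hc₁, mul_nonneg_iff_of_pos_left hc₂, mul_eq_zero, hc₁.ne', hc₂.ne',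
    h₃, h₃.le, h₃.ne', sub_pos, sub_nonneg, sub_eq_zero, lt_min_iff, and_true, false_or, or_false,
    true_and]
  rcases le_total u v with huv | huv
  · rw [min_eq_left huv]
    constructor
    · rintro ⟨⟨h1, h2⟩, h | h⟩ <;> linarith
    · rintro rfl
      exact ⟨⟨le_rfl, huv⟩, Or.inl rfl⟩
  · rw [min_eq_right huv]
    constructor
    · rintro ⟨⟨h1, h2⟩, h | h⟩ <;> linarith
    · rintro rfl
      exact ⟨⟨huv, le_rfl⟩, Or.inr rfl⟩

/-- At a boundary point at most two of the three inequalities that define the triangle are sharp.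
The last axis of the chart points out of the triangle along a rational unit vector that is
transversal to the two corresponding sides. -/
lemma hasLipschitzBoundary_triangle : HasLipschitzBoundary triangle := by
  intro p hp
  have hcont : ∀ O : Plane ≃ₗᵢ[ℝ] Plane, Tendsto O (𝓝 (O.symm p)) (𝓝 p) := fun O => by
    simpa using O.continuous.tendsto (O.symm p)
  have hmem : ∀ x y : ℝ, (pt x y ∈ triangle ↔ 0 < x ∧ 0 < y ∧ 0 < 1 / 2 - x - y) ∧
      (pt x y ∈ frontier triangle ↔ (0 ≤ x ∧ 0 ≤ y ∧ 0 ≤ 1 / 2 - x - y) ∧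
        (x = 0 ∨ y = 0 ∨ 1 / 2 - x - y = 0)) := fun x y => by
    have e1 : 0 < 1 / 2 - x - y ↔ x + y < 1 / 2 := by constructor <;> intro h <;> linarith
    have e2 : 0 ≤ 1 / 2 - x - y ↔ x + y ≤ 1 / 2 := by constructor <;> intro h <;> linarith
    have e3 : 1 / 2 - x - y = 0 ↔ x + y = 1 / 2 := by constructor <;> intro h <;> linarith
    rw [mem_frontier_triangle, e1, e2, e3]
    simp [triangle]
  have hcases : 0 < 1 / 2 - p 0 - p 1 ∨ 0 < p 0 ∨ 0 < p 1 := by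
    by_contra! h
    linarith [h.1, h.2.1, h.2.2]
  have h0 := continuous_coord 0
  have h1 := continuous_coord 1
  rcases hcases with h | h | h
  -- away from the hypotenuse the chart points towards the third quadrant
  · obtain ⟨K, hK⟩ := exists_lipschitzWith_min_affine (-3 / 4) (4 / 3) 0 0
    refine exists_lipschitz_chart hp (planeRotation (-3 / 5) (4 / 5) (by norm_num)) hK ?_
    filter_upwards [(hcont (planeRotation (-3 / 5) (4 / 5) (by norm_num))).eventually
      ((((continuous_const (y := (1 / 2 : ℝ))).sub h0).sub h1).tendsto p
        |>.eventually_const_lt h)] with z hz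
    rw [planeRotation_apply] at hz ⊢
    obtain ⟨hA, hB⟩ := lt_min_iff_and_eq_min_iff (t := z 1) (u := -3 / 4 * z 0 + 0)
      (v := 4 / 3 * z 0 + 0) (c₁ := 4 / 5) (c₂ := 3 / 5) (L₁ := -3 / 5 * z 0 - 4 / 5 * z 1)
      (L₂ := 4 / 5 * z 0 + -3 / 5 * z 1) (by norm_num) (by norm_num) (by ring) (by ring) hz
    rw [(hmem _ _).1, (hmem _ _).2, ← hA, ← hB]
    exact ⟨Iff.rfl, Iff.rfl⟩
  -- away from the vertical side it points out of the horizontal side and the hypotenuse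
  · obtain ⟨K, hK⟩ := exists_lipschitzWith_min_affine (-4 / 3) 7 0 (5 / 2)
    refine exists_lipschitz_chart hp (planeRotation (-3 / 5) (-4 / 5) (by norm_num)) hK ?_
    filter_upwards [(hcont (planeRotation (-3 / 5) (-4 / 5) (by norm_num))).eventually
      (h0.tendsto p |>.eventually_const_lt h)] with z hz
    rw [planeRotation_apply] at hz ⊢
    obtain ⟨hA, hB⟩ := lt_min_iff_and_eq_min_iff (t := z 1) (u := -4 / 3 * z 0 + 0)
      (v := 7 * z 0 + 5 / 2) (c₁ := 3 / 5) (c₂ := 1 / 5) (L₁ := -4 / 5 * z 0 + -3 / 5 * z 1)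
      (L₂ := 1 / 2 - (-3 / 5 * z 0 - -4 / 5 * z 1) - (-4 / 5 * z 0 + -3 / 5 * z 1))
      (L₃ := -3 / 5 * z 0 - -4 / 5 * z 1) (by norm_num) (by norm_num) (by ring) (by ring) hz
    rw [(hmem _ _).1, (hmem _ _).2, ← hA, ← hB]
    constructor <;> tauto
  -- away from the horizontal side it points out of the vertical side and the hypotenuse
  · obtain ⟨K, hK⟩ := exists_lipschitzWith_min_affine (4 / 3) (-7) 0 (5 / 2)
    refine exists_lipschitz_chart hp (planeRotation (4 / 5) (3 / 5) (by norm_num)) hK ?_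
    filter_upwards [(hcont (planeRotation (4 / 5) (3 / 5) (by norm_num))).eventually
      (h1.tendsto p |>.eventually_const_lt h)] with z hz
    rw [planeRotation_apply] at hz ⊢
    obtain ⟨hA, hB⟩ := lt_min_iff_and_eq_min_iff (t := z 1) (u := 4 / 3 * z 0 + 0)
      (v := -7 * z 0 + 5 / 2) (c₁ := 3 / 5) (c₂ := 1 / 5) (L₁ := 4 / 5 * z 0 - 3 / 5 * z 1)
      (L₂ := 1 / 2 - (4 / 5 * z 0 - 3 / 5 * z 1) - (3 / 5 * z 0 + 4 / 5 * z 1))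
      (L₃ := 3 / 5 * z 0 + 4 / 5 * z 1) (by norm_num) (by norm_num) (by ring) (by ring) hz
    rw [(hmem _ _).1, (hmem _ _).2, ← hA, ← hB]
    constructor <;> tauto

lemma isLipschitzSubdomain_triangle : IsLipschitzSubdomain unitDisc triangle where
  isOpen := isOpen_triangle
  isConnected := ⟨⟨pt (1 / 8) (1 / 8), by simp [triangle]; norm_num⟩,
    convex_triangle.isPreconnected⟩
  isCompact_closure :=
    (isCompact_closedBall 0 (1 / 2)).of_isClosed_subset isClosed_closure closure_triangle_subset
  closure_subset := closure_triangle_subset.trans (closedBall_subset_ball (by norm_num))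
  hasLipschitzBoundary := hasLipschitzBoundary_triangle
  isConnected_frontier := frontier_triangle ▸ isConnected_triangleSides

/-! ### Length measure on the sides of the triangle -/

lemma lengthOn_image_Icc {γ : ℝ → Plane} (hγ : Isometry γ) (a b : ℝ) :
    lengthOn (γ '' Icc a b) = Measure.map γ (volume.restrict (Icc a b)) := by
  have h := hγ.map_hausdorffMeasure (d := 1) (Or.inl zero_le_one)
  rw [hausdorffMeasure_real] at h
  have hm : MeasurableSet (γ '' Icc a b) := (isCompact_Icc.image hγ.continuous).measurableSet
  have h2 := congrArg (fun ν : Measure Plane => ν.restrict (γ '' Icc a b)) h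
  simp only [Measure.restrict_restrict hm, inter_eq_left.2 (image_subset_range _ _)] at h2
  rw [lengthOn, ← h2, Measure.restrict_map hγ.continuous.measurable hm,
    preimage_image_eq _ hγ.injective]

lemma integral_lengthOn_image_Icc {γ : ℝ → Plane} (hγ : Isometry γ) {a b : ℝ} (hab : a ≤ b)
    (f : Plane → ℝ) : ∫ y, f y ∂(lengthOn (γ '' Icc a b)) = ∫ t in a..b, f (γ t) := by
  rw [lengthOn_image_Icc hγ, hγ.isClosedEmbedding.measurableEmbedding.integral_map,
    intervalIntegral.integral_of_le hab, integral_Icc_eq_integral_Ioc]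

instance isFiniteMeasure_lengthOn_segment (p q : Plane) :
    IsFiniteMeasure (lengthOn (segment ℝ p q)) :=
  isFiniteMeasure_restrict.2 (by rw [hausdorffMeasure_segment]; exact edist_ne_top p q)

lemma measurableSet_segment (p q : Plane) : MeasurableSet (segment ℝ p q) := by
  rw [segment_eq_image']
  exact (isCompact_Icc.image (by fun_prop)).measurableSet

/-- The sides meet only in the vertices, which have length zero. -/
lemma lengthOn_triangleSides : lengthOn triangleSides =
    lengthOn (segment ℝ (pt 0 0) (pt (1 / 2) 0)) + lengthOn (segment ℝ (pt 0 0) (pt 0 (1 / 2))) +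
      lengthOn (segment ℝ (pt (1 / 2) 0) (pt 0 (1 / 2))) := by
  have := Measure.nullSingletonClass_hausdorff Plane (d := 1) one_pos
  have hnull : ∀ {s : Set Plane} (p q : Plane), s ⊆ {p, q} →
      (Measure.hausdorffMeasure 1 : Measure Plane) s = 0 :=
    fun p q hs => measure_mono_null hs ((toFinite {p, q}).measure_zero _)
  have hext : ∀ {x : Plane} {a b : ℝ}, x 0 = a → x 1 = b → x = pt a b := by
    intro x a b h0 h1
    ext i
    fin_cases i
    · simpa using h0
    · simpa using h1
  rw [lengthOn, triangleSides,
    Measure.restrict_union₀ _ (measurableSet_segment _ _).nullMeasurableSet,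
    Measure.restrict_union₀ _ (measurableSet_segment _ _).nullMeasurableSet]
  · refine hnull (pt 0 0) (pt 0 0) fun x ⟨h, h'⟩ => Or.inl ?_
    obtain ⟨t, ⟨ht0, ht1⟩, h0, h1⟩ := mem_segment_pt.1 h
    obtain ⟨s, ⟨hs0, hs1⟩, h0', h1'⟩ := mem_segment_pt.1 h'
    exact hext (by linarith) (by linarith)
  · refine hnull (pt (1 / 2) 0) (pt 0 (1 / 2)) fun x ⟨h, h'⟩ => ?_
    obtain ⟨s, ⟨hs0, hs1⟩, h0', h1'⟩ := mem_segment_pt.1 h'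
    rcases h with h | h
    · obtain ⟨t, ⟨ht0, ht1⟩, h0, h1⟩ := mem_segment_pt.1 h
      exact Or.inl (hext (by linarith) (by linarith))
    · obtain ⟨t, ⟨ht0, ht1⟩, h0, h1⟩ := mem_segment_pt.1 h
      exact Or.inr (hext (by linarith) (by linarith))

instance isFiniteMeasure_lengthOn_triangleSides : IsFiniteMeasure (lengthOn triangleSides) := by
  rw [lengthOn_triangleSides]
  infer_instance

lemma ae_mem_triangleSides : ∀ᵐ y ∂(lengthOn triangleSides), y ∈ triangleSides :=
  ae_restrict_mem isClosed_triangleSides.measurableSet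

lemma ae_norm_le_of_lengthOn_triangleSides :
    ∀ᵐ y ∂(lengthOn triangleSides), ‖y‖ ≤ 1 / 2 := by
  filter_upwards [ae_mem_triangleSides] with y hy
    using mem_closedBall_zero_iff.1 (triangleSides_subset hy)

lemma isometry_pt_right : Isometry fun t : ℝ => pt 0 t := by
  refine Isometry.of_dist_eq fun t t' => ?_
  rw [EuclideanSpace.dist_eq]
  simp [Fin.sum_univ_two, Real.sqrt_sq_eq_abs, Real.dist_eq]

lemma segment_eq_image_pt_left :
    segment ℝ (pt 0 0) (pt (1 / 2) 0) = (fun t : ℝ => pt t 0) '' Icc 0 (1 / 2) := by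
  ext x
  rw [mem_segment_pt]
  constructor
  · rintro ⟨t, ⟨ht0, ht1⟩, h0, h1⟩
    refine ⟨x 0, ⟨by linarith, by linarith⟩, ?_⟩
    ext i
    fin_cases i
    · simp
    · simp [h1]
  · rintro ⟨t, ⟨ht0, ht1⟩, rfl⟩
    exact ⟨2 * t, ⟨by linarith, by linarith⟩, by simp; ring, by simp⟩

lemma segment_eq_image_pt_right :
    segment ℝ (pt 0 0) (pt 0 (1 / 2)) = (fun t : ℝ => pt 0 t) '' Icc 0 (1 / 2) := by
  ext x
  rw [mem_segment_pt]
  constructor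
  · rintro ⟨t, ⟨ht0, ht1⟩, h0, h1⟩
    refine ⟨x 1, ⟨by linarith, by linarith⟩, ?_⟩
    ext i
    fin_cases i
    · simp [h0]
    · simp
  · rintro ⟨t, ⟨ht0, ht1⟩, rfl⟩
    exact ⟨2 * t, ⟨by linarith, by linarith⟩, by simp, by simp; ring⟩

/-! ### The logarithmic singularity at the corner -/

lemma norm_sub_pt_sq (x : Plane) (a b : ℝ) : ‖x - pt a b‖ ^ 2 = (x 0 - a) ^ 2 + (x 1 - b) ^ 2 := by
  rw [EuclideanSpace.norm_sq_eq, Fin.sum_univ_two]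
  simp

/-- The first partial derivative of `log |x - y|` with respect to `x`. -/
noncomputable def logKernelDeriv (x y : Plane) : ℝ := (x 0 - y 0) / ‖x - y‖ ^ 2

lemma abs_logKernelDeriv_le (x y : Plane) : |logKernelDeriv x y| ≤ ‖x - y‖⁻¹ := by
  have h : |x 0 - y 0| ≤ ‖x - y‖ := PiLp.norm_apply_le (x - y) 0
  rw [logKernelDeriv, abs_div, abs_of_nonneg (sq_nonneg ‖x - y‖)]
  rcases eq_or_ne ‖x - y‖ 0 with h0 | h0
  · simp [h0]
  · rw [div_le_iff₀ (by positivity)]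
    calc |x 0 - y 0| ≤ ‖x - y‖ := h
      _ = ‖x - y‖⁻¹ * ‖x - y‖ ^ 2 := by field_simp

/-- On the horizontal side the integrand is the derivative of `t ↦ -log |x - (t, 0)|`; this side
alone produces the singularity. -/
lemma integral_logKernelDeriv_left {x : Plane} (hx : x ∉ triangleSides) :
    ∫ y, logKernelDeriv x y ∂(lengthOn (segment ℝ (pt 0 0) (pt (1 / 2) 0))) =
      Real.log ‖x‖ - Real.log ‖x - pt (1 / 2) 0‖ := by
  have hpos : ∀ t ∈ uIcc (0 : ℝ) (1 / 2), (x 0 - t) ^ 2 + (x 1 - 0) ^ 2 ≠ 0 := by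
    intro t ht h
    rw [uIcc_of_le (by norm_num)] at ht
    rw [← norm_sub_pt_sq, sq_eq_zero_iff, norm_eq_zero, sub_eq_zero] at h
    refine hx (Or.inl (Or.inl ?_))
    rw [segment_eq_image_pt_left]
    exact ⟨t, ht, h.symm⟩
  rw [segment_eq_image_pt_left, integral_lengthOn_image_Icc (isometry_pt_left 0) (by norm_num)]
  have e : ∀ t : ℝ, logKernelDeriv x (pt t 0) = (x 0 - t) / ((x 0 - t) ^ 2 + (x 1 - 0) ^ 2) := by
    intro t
    rw [logKernelDeriv, norm_sub_pt_sq]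
    simp
  simp only [e]
  have hlog : ∀ t : ℝ, Real.log ((x 0 - t) ^ 2 + (x 1 - 0) ^ 2) / 2 = Real.log ‖x - pt t 0‖ := by
    intro t
    rw [← norm_sub_pt_sq, Real.log_pow]
    push_cast
    ring
  rw [intervalIntegral.integral_eq_sub_of_hasDerivAt
    (f := fun t => -(Real.log ((x 0 - t) ^ 2 + (x 1 - 0) ^ 2) / 2))]
  · simp only [hlog]
    have : pt 0 0 = 0 := by ext i; fin_cases i <;> simp
    rw [this, sub_zero]
    ring
  · intro t ht
    have h1 : HasDerivAt (fun t => (x 0 - t) ^ 2 + (x 1 - 0) ^ 2) (-(2 * (x 0 - t))) t := by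
      refine ((((hasDerivAt_id t).const_sub (x 0)).pow 2).add_const _).congr_deriv ?_
      simp
    refine (((h1.log (hpos t ht)).div_const 2).neg).congr_deriv ?_
    ring
  · refine ContinuousOn.intervalIntegrable (ContinuousOn.div (by fun_prop) (by fun_prop) hpos)

/-- On the vertical side the integrand is the derivative of an arctangent: it integrates to the
angle under which the side is seen from `x`, up to sign. -/
lemma abs_integral_logKernelDeriv_right_le (x : Plane) :
    |∫ y, logKernelDeriv x y ∂(lengthOn (segment ℝ (pt 0 0) (pt 0 (1 / 2))))| ≤ Real.pi := by
  rw [segment_eq_image_pt_right, integral_lengthOn_image_Icc isometry_pt_right (by norm_num)]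
  have e : ∀ t : ℝ, logKernelDeriv x (pt 0 t) = x 0 / (x 0 ^ 2 + (x 1 - t) ^ 2) := by
    intro t
    rw [logKernelDeriv, norm_sub_pt_sq]
    simp
  simp only [e]
  rcases eq_or_ne (x 0) 0 with h0 | h0
  · simp [h0, Real.pi_pos.le]
  · have hne : ∀ t : ℝ, x 0 ^ 2 + (x 1 - t) ^ 2 ≠ 0 := fun t => by positivity
    rw [intervalIntegral.integral_eq_sub_of_hasDerivAt
      (f := fun t => Real.arctan ((t - x 1) / x 0))]
    · have h1 := Real.arctan_lt_pi_div_two ((1 / 2 - x 1) / x 0)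
      have h2 := Real.neg_pi_div_two_lt_arctan ((1 / 2 - x 1) / x 0)
      have h3 := Real.arctan_lt_pi_div_two ((0 - x 1) / x 0)
      have h4 := Real.neg_pi_div_two_lt_arctan ((0 - x 1) / x 0)
      exact abs_le.2 ⟨by linarith, by linarith⟩
    · intro t _
      have h1 := (((hasDerivAt_id t).sub_const (x 1)).div_const (x 0)).arctan
      refine h1.congr_deriv ?_
      have h2 : 1 + ((t - x 1) / x 0) ^ 2 = (x 0 ^ 2 + (x 1 - t) ^ 2) / x 0 ^ 2 := by
        field_simp
        ring
      simp only [id_eq]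
      rw [h2]
      field_simp
    · exact (Continuous.div (by fun_prop) (by fun_prop) hne).intervalIntegrable _ _

/-- The hypotenuse keeps a positive distance from the corner. -/
lemma abs_integral_logKernelDeriv_hypotenuse_le {x : Plane} (hx : x ∈ ball (0 : Plane) (1 / 8)) :
    |∫ y, logKernelDeriv x y ∂(lengthOn (segment ℝ (pt (1 / 2) 0) (pt 0 (1 / 2))))| ≤
      8 * (lengthOn (segment ℝ (pt (1 / 2) 0) (pt 0 (1 / 2)))).real univ := by
  rw [← Real.norm_eq_abs]
  refine norm_integral_le_of_norm_le_const ?_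
  filter_upwards [ae_restrict_mem (measurableSet_segment _ _)] with y hy
  refine (abs_logKernelDeriv_le x y).trans ?_
  obtain ⟨t, ⟨ht0, ht1⟩, h0, h1⟩ := mem_segment_pt.1 hy
  have hy2 : 1 / 4 ≤ ‖y‖ := by
    refine le_of_sq_le_sq ?_ (norm_nonneg y)
    rw [EuclideanSpace.norm_sq_eq, Fin.sum_univ_two, Real.norm_eq_abs, Real.norm_eq_abs, sq_abs,
      sq_abs]
    nlinarith [sq_nonneg (y 0 - y 1)]
  rw [mem_ball_zero_iff] at hx
  have h3 : 1 / 8 ≤ ‖x - y‖ := by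
    have := norm_sub_norm_le y x
    rw [norm_sub_rev] at this
    linarith
  calc ‖x - y‖⁻¹ ≤ (1 / 8)⁻¹ := by gcongr
    _ = 8 := by norm_num

/-- The Green potential of the length measure on the sides of the triangle. -/
noncomputable abbrev trianglePotential : Plane → ℝ := greenPotential (lengthOn triangleSides)

lemma fderiv_trianglePotential {x : Plane} (hx : x ∈ unitDisc \ triangleSides) :
    fderiv ℝ trianglePotential x (basisVec 0) =
      ∫ y, greenKernelDeriv x y (basisVec 0) ∂(lengthOn triangleSides) := by
  obtain ⟨δ, hδ, hδx⟩ := exists_ball_dist_ge isClosed_triangleSides hx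
  rw [(hasFDerivAt_greenPotential ae_mem_triangleSides isClosed_triangleSides triangleSides_subset
    hx).fderiv]
  exact ContinuousLinearMap.integral_apply (integrable_greenKernelDeriv_of_dist ae_mem_triangleSides
    triangleSides_subset (hδx x (mem_ball_self hδ)).1 hδ (hδx x (mem_ball_self hδ)).2) _

/-- The derivative of the Green function is `-(1 / 2π)` times `logKernelDeriv` plus a bounded
reflected part, and of the three sides only the horizontal one contributes an unbounded term. -/
lemma exists_abs_fderiv_trianglePotential_add_log_le :
    ∃ C : ℝ, ∀ x ∈ ball (0 : Plane) (1 / 8) \ triangleSides,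
      |fderiv ℝ trianglePotential x (basisVec 0) + 1 / (2 * Real.pi) * Real.log ‖x‖| ≤ C := by
  refine ⟨2 + Real.pi + 8 * (lengthOn (segment ℝ (pt (1 / 2) 0) (pt 0 (1 / 2)))).real univ +
    3 * (lengthOn triangleSides).real univ, fun x hx => ?_⟩
  have hxd : x ∈ unitDisc \ triangleSides := ⟨ball_subset_ball (by norm_num) hx.1, hx.2⟩
  have hx8 := mem_ball_zero_iff.1 hx.1
  obtain ⟨δ, hδ, hδx⟩ := exists_ball_dist_ge isClosed_triangleSides hxd
  obtain ⟨hx1, hd⟩ := hδx x (mem_ball_self hδ)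
  -- the contribution of the mirror images
  set m : Plane → ℝ := fun y =>
    ((mirrorDistSq x y)⁻¹ • (‖y‖ ^ 2 • innerSL ℝ x - innerSL ℝ y)) (basisVec 0)
  have hm3 : ∀ᵐ y ∂(lengthOn triangleSides), ‖m y‖ ≤ 3 := by
    filter_upwards [ae_norm_le_of_lengthOn_triangleSides] with y hy
    exact (abs_apply_basisVec_le _ 0).trans (norm_mirror_gradient_le hx1 hy)
  have hmi : Integrable m (lengthOn triangleSides) := by
    have hmm : Measurable fun y : Plane => (mirrorDistSq x y)⁻¹ :=
      (measurable_mirrorDistSq.comp measurable_prodMk_left).inv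
    have hmc : Continuous fun y : Plane => (‖y‖ ^ 2 • innerSL ℝ x - innerSL ℝ y) (basisVec 0) := by
      fun_prop
    exact Integrable.mono' (integrable_const 3) (hmm.mul hmc.measurable).aestronglyMeasurable hm3
  have hki : Integrable (logKernelDeriv x) (lengthOn triangleSides) := by
    refine Integrable.mono' (integrable_const δ⁻¹) ?_ ?_
    · unfold logKernelDeriv
      exact Measurable.aestronglyMeasurable (by fun_prop)
    · filter_upwards [ae_mem_triangleSides] with y hy
      refine (abs_logKernelDeriv_le x y).trans ?_
      gcongr
      exact hd y hy
  have e1 : fderiv ℝ trianglePotential x (basisVec 0) = -(1 / (2 * Real.pi)) *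
      ((∫ y, logKernelDeriv x y ∂(lengthOn triangleSides)) -
        ∫ y, m y ∂(lengthOn triangleSides)) := by
    rw [fderiv_trianglePotential hxd, ← integral_sub hki hmi, ← integral_const_mul]
    refine integral_congr_ae (Eventually.of_forall fun y => ?_)
    simp only [m, greenKernelDeriv, smul_apply, sub_apply, innerSL_apply_apply, smul_eq_mul,
      logKernelDeriv, EuclideanSpace.inner_single_right, PiLp.sub_apply]
    simp
    ring
  have hI := hki
  rw [lengthOn_triangleSides, integrable_add_measure, integrable_add_measure] at hI
  have e2 : ∫ y, logKernelDeriv x y ∂(lengthOn triangleSides) =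
      Real.log ‖x‖ - Real.log ‖x - pt (1 / 2) 0‖ +
      (∫ y, logKernelDeriv x y ∂(lengthOn (segment ℝ (pt 0 0) (pt 0 (1 / 2))))) +
      ∫ y, logKernelDeriv x y ∂(lengthOn (segment ℝ (pt (1 / 2) 0) (pt 0 (1 / 2)))) := by
    rw [lengthOn_triangleSides, integral_add_measure (hI.1.1.add_measure hI.1.2) hI.2,
      integral_add_measure hI.1.1 hI.1.2, integral_logKernelDeriv_left hx.2]
  have hlog : |Real.log ‖x - pt (1 / 2) 0‖| ≤ 2 := by
    have hn : ‖pt (1 / 2) 0‖ = 1 / 2 := by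
      rw [EuclideanSpace.norm_eq, Fin.sum_univ_two]
      simp
    have h1 : 3 / 8 ≤ ‖x - pt (1 / 2) 0‖ := by
      have := norm_sub_norm_le (pt (1 / 2) 0) x
      rw [norm_sub_rev] at this
      linarith
    have h2 : ‖x - pt (1 / 2) 0‖ ≤ 1 := by linarith [norm_sub_le x (pt (1 / 2) 0)]
    have h3 := Real.one_sub_inv_le_log_of_pos (x := ‖x - pt (1 / 2) 0‖) (by linarith)
    have h4 := Real.log_nonpos (norm_nonneg _) h2
    have h5 : ‖x - pt (1 / 2) 0‖⁻¹ ≤ (3 / 8)⁻¹ := by gcongr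
    rw [abs_le]
    constructor <;> linarith
  have hM : |∫ y, m y ∂(lengthOn triangleSides)| ≤ 3 * (lengthOn triangleSides).real univ :=
    norm_integral_le_of_norm_le_const hm3
  have hr := abs_integral_logKernelDeriv_right_le x
  have hh := abs_integral_logKernelDeriv_hypotenuse_le hx.1
  rw [e1, e2]
  set a := ∫ y, logKernelDeriv x y ∂(lengthOn (segment ℝ (pt 0 0) (pt 0 (1 / 2))))
  set b := ∫ y, logKernelDeriv x y ∂(lengthOn (segment ℝ (pt (1 / 2) 0) (pt 0 (1 / 2))))
  set M := ∫ y, m y ∂(lengthOn triangleSides)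
  set l := Real.log ‖x - pt (1 / 2) 0‖
  have e3 : -(1 / (2 * Real.pi)) * (Real.log ‖x‖ - l + a + b - M) +
      1 / (2 * Real.pi) * Real.log ‖x‖ = 1 / (2 * Real.pi) * (l - a - b + M) := by ring
  rw [e3, abs_mul, abs_of_pos (by positivity)]
  calc 1 / (2 * Real.pi) * |l - a - b + M| ≤ 1 * |l - a - b + M| := by
        gcongr; exact one_div_two_pi_le_one
    _ ≤ _ := by
        rw [one_mul, abs_le]
        rw [abs_le] at hlog hM hr hh
        constructor <;> linarith [hlog.1, hlog.2, hM.1, hM.2, hr.1, hr.2, hh.1, hh.2]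

/-! ### Regularity of the solution -/

lemma isVeryWeakSolution_trianglePotential :
    IsVeryWeakSolution unitDisc (lengthOn triangleSides) trianglePotential :=
  isVeryWeakSolution_greenPotential ae_norm_le_of_lengthOn_triangleSides

lemma IsVeryWeakSolution.ae_eq {μ : Measure Plane} {u w : Plane → ℝ}
    (hu : IsVeryWeakSolution unitDisc μ u) (hw : IsVeryWeakSolution unitDisc μ w) :
    u =ᵐ[volume.restrict unitDisc] w := by
  have h := ae_eq_zero_of_integral_mul_laplacian_eq_zero (hu.memLp.sub hw.memLp)
    fun φ hφ h0 => ?_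
  · filter_upwards [h] with x hx using sub_eq_zero.1 hx
  · have hfr : ∀ x ∈ frontier unitDisc, φ x = 0 := by
      rw [frontier_ball _ one_ne_zero]
      exact h0
    have h1 := hu.integral_eq φ hφ.contDiffOn hfr
    have h2 := hw.integral_eq φ hφ.contDiffOn hfr
    obtain ⟨F, hF, hFφ⟩ := exists_continuousOn_eq_laplacian_plane hφ.contDiffOn
    obtain ⟨C, hC⟩ := (isCompact_closedBall (0 : Plane) 1).exists_bound_of_continuousOn hF
    have hint : ∀ {v : Plane → ℝ}, MemLp v 2 (volume.restrict unitDisc) →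
        IntegrableOn (fun x => v x * Laplacian.laplacian φ x) unitDisc := by
      intro v hv
      have hv1 : IntegrableOn v unitDisc := hv.integrable (by norm_num)
      have : IntegrableOn (fun x => v x * F x) unitDisc := by
        refine Integrable.mul_bdd (c := C) hv1
          ((hF.mono ball_subset_closedBall).aestronglyMeasurable measurableSet_ball) ?_
        filter_upwards [ae_restrict_mem measurableSet_ball] with x hx
        exact hC x (ball_subset_closedBall hx)
      exact this.congr_fun (fun x hx => by simp only [hFφ x hx]) measurableSet_ball
    simp only [Pi.sub_apply, sub_mul]
    rw [integral_sub (hint hu.memLp) (hint hw.memLp)]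
    linarith

lemma ae_notMem_triangleSides (Ω : Set Plane) :
    ∀ᵐ x ∂(volume.restrict Ω), x ∉ triangleSides :=
  ae_restrict_of_ae (measure_eq_zero_iff_ae_notMem.1 volume_triangleSides)

lemma hasWeakPartialDeriv_trianglePotential :
    HasWeakPartialDeriv unitDisc 0 trianglePotential
      (fun x => fderiv ℝ trianglePotential x (basisVec 0)) := by
  refine (hasWeakPartialDeriv_greenPotential ae_norm_le_of_lengthOn_triangleSides).congr
    (EventuallyEq.refl _ _) ?_
  filter_upwards [ae_restrict_mem measurableSet_ball, ae_notMem_triangleSides unitDisc]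
    with x hx hx'
  exact (fderiv_trianglePotential ⟨hx, hx'⟩).symm

/-- A bounded weak derivative would agree almost everywhere with the pointwise one, which is
unbounded near the corner. -/
lemma not_memW1Infty {u : Plane → ℝ}
    (hu : IsVeryWeakSolution unitDisc (lengthOn triangleSides) u) : ¬ MemW1Infty unitDisc u := by
  intro h
  obtain ⟨g, hg, hug⟩ := h.exists_deriv 0
  obtain ⟨C, hC⟩ := exists_abs_fderiv_trianglePotential_add_log_le
  have hv := hasWeakPartialDeriv_trianglePotential.congr
    (isVeryWeakSolution_trianglePotential.ae_eq hu) (EventuallyEq.refl _ _)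
  have hgv := hug.ae_eq isOpen_ball hv
  set M : ℝ := (eLpNormEssSup g (volume.restrict unitDisc)).toReal
  have hgM : ∀ᵐ x ∂(volume.restrict unitDisc), ‖g x‖ ≤ M := by
    have hfin : eLpNormEssSup g (volume.restrict unitDisc) ≠ ⊤ := by
      rw [← eLpNorm_exponent_top]
      exact hg.2.ne
    filter_upwards [ae_le_eLpNormEssSup (f := g) (μ := volume.restrict unitDisc)] with x hx
    have := ENNReal.toReal_mono hfin hx
    simpa using this
  -- on this ball the logarithm dominates both constants
  set ρ : ℝ := min (1 / 8) (Real.exp (-(2 * Real.pi * (M + C + 1))))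
  have hρ : 0 < ρ := lt_min (by norm_num) (Real.exp_pos _)
  have hsub : ball (0 : Plane) ρ ⊆ unitDisc :=
    ball_subset_ball ((min_le_left _ _).trans (by norm_num))
  have hfalse : ∀ᵐ x ∂(volume.restrict (ball (0 : Plane) ρ)), False := by
    filter_upwards [ae_restrict_mem measurableSet_ball, ae_notMem_triangleSides (ball 0 ρ),
      ae_restrict_of_ae_restrict_of_subset hsub hgM, ae_restrict_of_ae_restrict_of_subset hsub hgv]
      with x hx hxs hxM hxg
    have hx0 : x ≠ 0 := by
      rintro rfl
      refine hxs (Or.inl (Or.inl ?_))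
      have : pt 0 0 = 0 := by ext i; fin_cases i <;> simp
      rw [← this]
      exact left_mem_segment ℝ _ _
    have hxn := mem_ball_zero_iff.1 hx
    have h1 := hC x ⟨ball_subset_ball (min_le_left _ _) hx, hxs⟩
    rw [← hxg, abs_le] at h1
    rw [Real.norm_eq_abs, abs_le] at hxM
    have h2 : Real.log ‖x‖ < -(2 * Real.pi * (M + C + 1)) :=
      (Real.log_lt_iff_lt_exp (norm_pos_iff.2 hx0)).2 (hxn.trans_le (min_le_right _ _))
    have h3 : 1 / (2 * Real.pi) * Real.log ‖x‖ < -(M + C + 1) := by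
      rw [div_mul_eq_mul_div, one_mul, div_lt_iff₀ Real.two_pi_pos]
      linarith
    linarith [h1.1, hxM.2]
  have hz : volume.restrict (ball (0 : Plane) ρ) = 0 := by
    rw [← ae_eq_bot]
    exact eventually_false_iff_eq_bot.1 hfalse
  rw [Measure.restrict_eq_zero] at hz
  exact (measure_ball_pos volume (0 : Plane) hρ).ne' hz

end SurfacePoisson

open SurfacePoisson in
theorem mainTheorem3 :
    -- the triangle is a Lipschitz subdomain of the disc, and its boundary consists of its sides
    IsLipschitzSubdomain unitDisc triangle ∧
    frontier triangle = triangleSides ∧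
    -- the problem has a very weak solution, and only one
    (∃ u : Plane → ℝ, IsVeryWeakSolution unitDisc (lengthOn triangleSides) u) ∧
    (∀ u w : Plane → ℝ, IsVeryWeakSolution unitDisc (lengthOn triangleSides) u →
      IsVeryWeakSolution unitDisc (lengthOn triangleSides) w →
      u =ᵐ[volume.restrict unitDisc] w) ∧
    -- no solution is in `W^{1,∞}`
    (¬ ∃ u : Plane → ℝ, IsVeryWeakSolution unitDisc (lengthOn triangleSides) u ∧
      MemW1Infty unitDisc u) ∧
    -- `∂₁ u = -(1 / 2π) log |x| + O(1)` near the corner at the origin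
    (∀ u : Plane → ℝ, IsVeryWeakSolution unitDisc (lengthOn triangleSides) u →
      ∃ (v : Plane → ℝ) (ε C : ℝ), 0 < ε ∧ ε < 1 ∧
        u =ᵐ[volume.restrict unitDisc] v ∧
        ContDiffOn ℝ 1 v (ball 0 ε \ triangleSides) ∧
        HasWeakPartialDeriv (ball 0 ε) 0 u (fun x => fderiv ℝ v x (basisVec 0)) ∧
        ∀ x ∈ ball (0 : Plane) ε \ triangleSides,
          |fderiv ℝ v x (basisVec 0) + 1 / (2 * Real.pi) * Real.log ‖x‖| ≤ C) ∧
    -- so a Lipschitz boundary is not enough for `W^{1,∞}`-regularity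
    (¬ ∀ D : Set Plane, IsLipschitzSubdomain unitDisc D →
      ∀ u : Plane → ℝ, IsVeryWeakSolution unitDisc (lengthOn (frontier D)) u →
        MemW1Infty unitDisc u) := by
  refine ⟨isLipschitzSubdomain_triangle, frontier_triangle,
    ⟨_, isVeryWeakSolution_trianglePotential⟩, fun u w hu hw => hu.ae_eq hw,
    fun ⟨u, hu, hW⟩ => not_memW1Infty hu hW, fun u hu => ?_, fun h => ?_⟩
  · obtain ⟨C, hC⟩ := exists_abs_fderiv_trianglePotential_add_log_le
    have huv := hu.ae_eq isVeryWeakSolution_trianglePotential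
    have hsub : ball (0 : Plane) (1 / 8) ⊆ unitDisc := ball_subset_ball (by norm_num)
    refine ⟨trianglePotential, 1 / 8, C, by norm_num, by norm_num, huv, ?_, ?_, hC⟩
    · exact (contDiffOn_greenPotential ae_mem_triangleSides isClosed_triangleSides
        triangleSides_subset).mono (sdiff_subset_sdiff_left hsub)
    · exact (hasWeakPartialDeriv_trianglePotential.congr huv.symm
        (EventuallyEq.refl _ _)).mono hsub
  · have hu := isVeryWeakSolution_trianglePotential
    refine not_memW1Infty hu (h triangle isLipschitzSubdomain_triangle _ ?_)
    rw [frontier_triangle]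
    exact hu
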